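/- Let $d\ge 1$, let $\Xi$ be a Markov kernel from $\mathbb R^d$ to a measurable space $S$, and let $F:\mathbb R^d\times S\to\mathbb R$ be measurable. Assume that for all $x\in\mathbb R^d$ $$\mathbb E_{\xi\sim\Xi(x)}[F(x;\xi)]=f(x),\qquad \mathbb E_{\xi\sim\Xi(x)}\big[|F(x;\xi)-f(x)|^2\big]\le\sigma^2,$$ and that $f:\mathbb R^d\to\mathbb R$ is $L$-Lipschitz for the Euclidean norm. For $\delta>0$ let $f_\delta(x)=\mathbb E_{u\sim\mathrm{Unif}(\mathbb B^d)}[f(x+\delta u)]$, where $\mathbb B^d$ is the closed unit ball and $\mathbb S^{d-1}$ the unit sphere. Let $\mathcal F_{-1}\subseteq\mathcal F_0\subseteq\mathcal F_1\subseteq\cdots$ be a filtration on a probability space and let $y_t,u_t$ (in $\mathbb R^d$) and $\xi_t$ (in $S$), $t\ge 0$, be random variables such that for every $t\ge0$: $y_t$ is $\mathcal F_{t-1}$-measurable; $u_t$ and $\xi_t$ are $\mathcal F_t$-measurable; $u_t\sim\mathrm{Unif}(\mathbb S^{d-1})$ is independent of $\mathcal F_{t-1}$; and the conditional law of $\xi_t$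 given $(\mathcal F_{t-1},u_t)$ is $\Xi(y_t+\delta u_t)$. For $t\ge 1$ put $$g_t=\frac d\delta\big(F(y_t+\delta u_t;\xi_t)-F(y_{t-1}+\delta u_{t-1};\xi_{t-1})\big)u_t .$$ Then $f_\delta$ is differentiable on $\mathbb R^d$, and for every $t\ge1$: (i) if $g_t$ is integrable (which is the case whenever $\mathbb E\|y_t-y_{t-1}\|<\infty$), then $\mathbb E[g_t\mid\mathcal F_{t-1}]=\nabla f_\delta(y_t)$ almost surely; (ii) in $[0,\infty]$, with $0\cdot\infty=0$, $$\mathbb E\big[\|g_t\|^2\big]\le\frac{6d^2\sigma^2}{\delta^2}+144\sqrt{2\pi}\,dL^2+\frac{6d^2L^2}{\delta^2}\,\mathbb E\big[\|y_t-y_{t-1}\|^2\big].$$ -/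

import Mathlib

open MeasureTheory ProbabilityTheory
open scoped NNReal ENNReal

/-- The uniform distribution on the closed unit ball of `ℝ^d`. -/
noncomputable def unifBall (d : ℕ) : Measure (EuclideanSpace ℝ (Fin d)) :=
  ProbabilityTheory.cond volume (Metric.closedBall 0 1)

/-- The uniform distribution on the unit sphere of `ℝ^d`: the normalized surface measure,
regarded as a measure on `ℝ^d`. -/
noncomputable def unifSphere (d : ℕ) : Measure (EuclideanSpace ℝ (Fin d)) :=
  ((volume : Measure (EuclideanSpace ℝ (Fin d))).toSphere Set.univ)⁻¹ •
    ((volume : Measure (EuclideanSpace ℝ (Fin d))).toSphere.map Subtype.val)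

/-- The smoothed surrogate `f_δ(x) = E_{u ∼ Unif(𝔹^d)} [f (x + δ u)]`. -/
noncomputable def smoothedSurrogate {d : ℕ} (f : EuclideanSpace ℝ (Fin d) → ℝ) (δ : ℝ)
    (x : EuclideanSpace ℝ (Fin d)) : ℝ :=
  ∫ u, f (x + δ • u) ∂(unifBall d)

/-- `F` is a stochastic zeroth-order oracle for `f` with noise level `σ`, under the
decision-dependent sampling law `Ξ`: at every `x`, the value `F x s` with `s ∼ Ξ x` has mean
`f x` and variance at most `σ ^ 2`. -/
structure IsStochasticOracle {d : ℕ} {S : Type*} [MeasurableSpace S]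
    (Ξ : Kernel (EuclideanSpace ℝ (Fin d)) S) (F : EuclideanSpace ℝ (Fin d) → S → ℝ)
    (f : EuclideanSpace ℝ (Fin d) → ℝ) (σ : ℝ) : Prop where
  integrable : ∀ x, Integrable (F x) (Ξ x)
  mean_eq : ∀ x, ∫ s, F x s ∂(Ξ x) = f x
  variance_le : ∀ x, ∫⁻ s, ‖F x s - f x‖ₑ ^ 2 ∂(Ξ x) ≤ ENNReal.ofReal (σ ^ 2)

/-- The one-point residual estimator
`(d / δ) (F(y + δ u; ξ) - F(y' + δ u'; ξ')) u`, where the primed data come from the previous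
query. -/
noncomputable def onePointResidual {d : ℕ} {S : Type*} (F : EuclideanSpace ℝ (Fin d) → S → ℝ)
    (δ : ℝ) (y u : EuclideanSpace ℝ (Fin d)) (ξ : S)
    (y' u' : EuclideanSpace ℝ (Fin d)) (ξ' : S) : EuclideanSpace ℝ (Fin d) :=
  ((d : ℝ) / δ * (F (y + δ • u) ξ - F (y' + δ • u') ξ')) • u

/-- The sampling protocol with one query per iteration. The σ-algebra `𝒢 t` holds everything
known just before the query of iteration `t`, that is, all randomness revealed through iteration
`t - 1` together with the randomness used to form `y t`. Given this information, the direction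
`u t` is fresh and uniform on the unit sphere, and the sample `ξ t` is then drawn from
`Ξ (y t + δ • u t)`. -/
structure IsOnePointSampling {d : ℕ} {S Ω : Type*} [MeasurableSpace S] [mΩ : MeasurableSpace Ω]
    (μ : Measure Ω) (Ξ : Kernel (EuclideanSpace ℝ (Fin d)) S) (δ : ℝ) (𝒢 : Filtration ℕ mΩ)
    (y u : ℕ → Ω → EuclideanSpace ℝ (Fin d)) (ξ : ℕ → Ω → S) : Prop where
  measurable_point : ∀ t, Measurable[𝒢 t] (y t)
  measurable_direction : ∀ t, Measurable[𝒢 (t + 1)] (u t)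
  measurable_sample : ∀ t, Measurable[𝒢 (t + 1)] (ξ t)
  law_direction : ∀ t, μ.map (u t) = unifSphere d
  indep_direction : ∀ t, Indep (MeasurableSpace.comap (u t) inferInstance) (𝒢 t) μ
  /-- the conditional law of `ξ t` given `𝒢 t` and `u t` is `Ξ (y t + δ • u t)` -/
  condLaw_sample : ∀ t (B : Set S), MeasurableSet B →
    μ[(ξ t ⁻¹' B).indicator (fun _ => (1 : ℝ)) |
        𝒢 t ⊔ MeasurableSpace.comap (u t) inferInstance]
      =ᵐ[μ] fun ω => (Ξ (y t ω + δ • u t ω)).real B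

/-! Unbiasedness. The divergence theorem on the unit ball (`integral_ball_lineDeriv`) turns the
gradient of the smoothed function into `d / δ` times the spherical mean of `f (x + δ u) u`
(`hasGradientAt_smoothedSurrogate`). In the residual, replace the new oracle value by `f` at the
query point: the error is centered given the past and the direction. The previous oracle value is
known before the fresh direction is drawn, so it drops out because the direction has mean zero
(`integral_id_unifSphere`).

Second moment. The residual difference splits into the two oracle noises, a term `B` that moves the
base point under the new direction, and a term `D` that changes the direction at the old base point.
The noises are bounded by `σ`, and `B` by the Lipschitz property. The split uses the old point
because it is independent of both directions, whereas the new point may depend on the previous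
direction. Thus `D` is, given the old point, a difference of a Lipschitz function at two independent
uniform directions.

The gain of a factor `d` is concentration on the sphere (`lintegral_enorm_sub_sq_unifSphere`). It
comes from a Gaussian Poincaré inequality for two independent copies, since the direction of a
Gaussian vector is uniform (`map_inv_norm_smul_stdGaussian`) and its norm fluctuates only by `O(1)`
around a mean of order `√d`. The resulting numerical constant fits below the stated one. -/

/-! ### Polar coordinates for a Haar measure. -/

section Polar

variable {E : Type*} [NormedAddCommGroup E] [NormedSpace ℝ E] [MeasurableSpace E] [BorelSpace E]
  [FiniteDimensional ℝ E] [Nontrivial E] (μ : Measure E) [μ.IsAddHaarMeasure]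

/-- Polar coordinates: `(u, r) ↦ r • u` pushes the product of the surface measure and the radial
measure to the Haar measure. -/
theorem measurePreserving_smul_sphere :
    MeasurePreserving (fun p : Metric.sphere (0 : E) 1 × Set.Ioi (0 : ℝ) => p.2.1 • p.1.1)
      (μ.toSphere.prod (Measure.volumeIoiPow (Module.finrank ℝ E - 1))) μ := by
  have h1 := (μ.measurePreserving_homeomorphUnitSphereProd).symm
    (homeomorphUnitSphereProd E).toMeasurableEquiv
  have h2 : MeasurePreserving ((↑) : ({0}ᶜ : Set E) → E) (μ.comap (↑)) μ := by
    have := measurePreserving_subtype_coe (μa := μ) (s := ({0}ᶜ : Set E))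
      (measurableSet_singleton _).compl
    rwa [restrict_compl_singleton] at this
  have h3 := h2.comp h1
  convert! h3 using 1

theorem integral_volumeIoiPow {F : Type*} [NormedAddCommGroup F] [NormedSpace ℝ F] (n : ℕ)
    (h : ℝ → F) :
    ∫ r, h r.1 ∂(Measure.volumeIoiPow n) = ∫ r in Set.Ioi (0 : ℝ), r ^ n • h r := by
  simp only [Measure.volumeIoiPow, ENNReal.ofReal]
  rw [integral_withDensity_eq_integral_smul,
    integral_subtype_comap measurableSet_Ioi fun a ↦ Real.toNNReal (a ^ n) • h a,
    setIntegral_congr_fun measurableSet_Ioi fun x hx ↦ ?_]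
  · rw [NNReal.smul_def, Real.coe_toNNReal _ (pow_nonneg hx.out.le _)]
  · exact (measurable_subtype_coe.pow_const _).real_toNNReal

theorem integral_eq_integral_sphere {F : Type*} [NormedAddCommGroup F] [NormedSpace ℝ F]
    {G : E → F} (hG : Integrable G μ) :
    ∫ x, G x ∂μ = ∫ r in Set.Ioi (0 : ℝ),
      r ^ (Module.finrank ℝ E - 1) • ∫ u, G (r • u.1) ∂μ.toSphere := by
  have hmp := measurePreserving_smul_sphere μ
  have hi := hmp.integrable_comp_of_integrable hG
  have h1 : ∫ x, G x ∂μ = ∫ p, G (p.2.1 • p.1.1)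
      ∂(μ.toSphere.prod (Measure.volumeIoiPow (Module.finrank ℝ E - 1))) := by
    conv_lhs => rw [← hmp.map_eq]
    rw [integral_map hmp.aemeasurable (by rw [hmp.map_eq]; exact hG.1)]
  rw [h1, integral_prod_symm (fun p : Metric.sphere (0 : E) 1 × Set.Ioi (0 : ℝ) =>
    G (p.2.1 • p.1.1)) hi]
  exact integral_volumeIoiPow _ (fun r => ∫ u, G (r • u.1) ∂μ.toSphere)

end Polar

/-! ### Uniform laws on the sphere and the ball. -/

section Sphere

variable {d : ℕ}

theorem volume_ball_pos : 0 < (volume : Measure (EuclideanSpace ℝ (Fin d))).real (Metric.ball 0 1) :=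
  ENNReal.toReal_pos (Metric.measure_ball_pos _ _ one_pos).ne' measure_ball_lt_top.ne

theorem integral_unifSphere {F : Type*} [NormedAddCommGroup F] [NormedSpace ℝ F]
    (G : EuclideanSpace ℝ (Fin d) → F) :
    ∫ u, G u ∂(unifSphere d) =
      ((d : ℝ) * (volume : Measure (EuclideanSpace ℝ (Fin d))).real (Metric.ball 0 1))⁻¹ •
        ∫ u, G u.1 ∂(volume : Measure (EuclideanSpace ℝ (Fin d))).toSphere := by
  rw [unifSphere, integral_smul_measure,
    (MeasurableEmbedding.subtype_coe Metric.isClosed_sphere.measurableSet).integral_map]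
  congr 1
  simp [measureReal_def]

theorem isProbabilityMeasure_unifSphere (hd : 1 ≤ d) : IsProbabilityMeasure (unifSphere d) := by
  have : Nonempty (Fin d) := ⟨⟨0, hd⟩⟩
  constructor
  rw [unifSphere, Measure.smul_apply, Measure.map_apply measurable_subtype_coe .univ,
    Set.preimage_univ, smul_eq_mul, ENNReal.inv_mul_cancel]
  · rw [Measure.toSphere_apply_univ]
    have := (Metric.measure_ball_pos (volume : Measure (EuclideanSpace ℝ (Fin d))) 0 one_pos).ne'
    simp only [finrank_euclideanSpace, Fintype.card_fin]
    exact mul_ne_zero (by exact_mod_cast (by omega : d ≠ 0)) this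
  · exact measure_ne_top _ _

theorem ae_unifSphere_norm : ∀ᵐ u ∂(unifSphere d), ‖u‖ = 1 := by
  rw [unifSphere]
  refine Measure.ae_smul_measure ?_ _
  rw [ae_map_iff measurable_subtype_coe.aemeasurable
    (measurableSet_eq_fun measurable_norm measurable_const)]
  exact .of_forall fun u => by simp

theorem integral_unifBall {F : Type*} [NormedAddCommGroup F] [NormedSpace ℝ F]
    (G : EuclideanSpace ℝ (Fin d) → F) :
    ∫ u, G u ∂(unifBall d) =
      ((volume : Measure (EuclideanSpace ℝ (Fin d))).real (Metric.ball 0 1))⁻¹ •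
        ∫ u in Metric.ball 0 1, G u := by
  rw [unifBall, ProbabilityTheory.cond, integral_smul_measure]
  congr 1
  · rw [Measure.addHaar_unitClosedBall_eq_addHaar_unitBall, ENNReal.toReal_inv, measureReal_def]
  · rw [Measure.restrict_congr_set (ae_eq_of_subset_of_measure_ge Metric.ball_subset_closedBall
      (Measure.addHaar_unitClosedBall_eq_addHaar_unitBall _).le
      Metric.isOpen_ball.measurableSet.nullMeasurableSet measure_closedBall_lt_top.ne).symm]

instance isProbabilityMeasure_unifBall : IsProbabilityMeasure (unifBall d) := by
  unfold unifBall
  refine cond_isProbabilityMeasure_of_finite ?_ ?_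
  · exact (Metric.measure_closedBall_pos _ _ one_pos).ne'
  · exact measure_closedBall_lt_top.ne

theorem ae_unifBall_norm : ∀ᵐ u ∂(unifBall d), ‖u‖ ≤ 1 := by
  rw [unifBall, ProbabilityTheory.cond]
  refine Measure.ae_smul_measure ?_ _
  filter_upwards [ae_restrict_mem Metric.isClosed_closedBall.measurableSet] with u hu
  simpa using hu

theorem unifBall_absolutelyContinuous :
    unifBall d ≪ (volume : Measure (EuclideanSpace ℝ (Fin d))) :=
  ProbabilityTheory.cond_absolutelyContinuous

end Sphere

/-! ### The divergence theorem on the unit ball for Lipschitz functions. -/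

section DivergenceTheorem

open scoped RealInnerProductSpace Topology

/-- The cone `(R - ‖w‖)₊` is the test function for the divergence theorem: it is Lipschitz with
compact support, and its derivative in `R` is the indicator of the ball. -/
theorem lipschitzWith_max_sub_norm {E : Type*} [SeminormedAddCommGroup E] (R : ℝ) :
    LipschitzWith 1 (fun w : E => max (R - ‖w‖) 0) := by
  have : LipschitzWith 1 (fun w : E => R - ‖w‖) := by
    refine LipschitzWith.of_dist_le_mul fun x y => ?_
    simp only [NNReal.coe_one, one_mul, dist_eq_norm, Real.norm_eq_abs]
    rw [show R - ‖x‖ - (R - ‖y‖) = -(‖x‖ - ‖y‖) by ring, abs_neg]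
    exact abs_norm_sub_norm_le x y
  exact this.max_const 0

variable {E : Type*} [NormedAddCommGroup E] [InnerProductSpace ℝ E]

theorem lineDeriv_norm_of_ne_zero {w : E} (hw : w ≠ 0) (v : E) :
    HasLineDerivAt ℝ (fun x : E => ‖x‖) (⟪w, v⟫ / ‖w‖) w v := by
  have h1 : HasFDerivAt (fun x : E => ‖x‖ ^ 2) (2 • innerSL ℝ w) w :=
    (hasStrictFDerivAt_norm_sq w).hasFDerivAt
  have h2 := h1.sqrt (by simpa using hw)
  have h3 : (fun x : E => √(‖x‖ ^ 2)) = fun x => ‖x‖ := by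
    ext x; exact Real.sqrt_sq (norm_nonneg x)
  rw [h3] at h2
  have h4 := h2.hasLineDerivAt v
  convert! h4 using 1
  simp [Real.sqrt_sq (norm_nonneg w)]
  field_simp

theorem lineDeriv_max_sub_norm {R : ℝ} {w : E} (hw : w ≠ 0) (hwR : ‖w‖ ≠ R) (v : E) :
    lineDeriv ℝ (fun w : E => max (R - ‖w‖) 0) w (-v) =
      (Metric.ball (0 : E) R).indicator (fun w => ⟪w, v⟫ / ‖w‖) w := by
  rcases lt_or_gt_of_ne hwR with h | h
  · have he : (fun w : E => max (R - ‖w‖) 0) =ᶠ[𝓝 w] fun w => R - ‖w‖ := by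
      filter_upwards [(isOpen_lt continuous_norm continuous_const).mem_nhds h] with x hx
      exact max_eq_left (by simpa using le_of_lt hx)
    rw [he.lineDeriv_eq, Set.indicator_of_mem (by simpa using h)]
    have h1 := lineDeriv_norm_of_ne_zero hw (-v)
    have h2 : HasLineDerivAt ℝ (fun x : E => R - ‖x‖) (-(⟪w, -v⟫ / ‖w‖)) w (-v) :=
      HasDerivAt.const_sub R h1
    rw [h2.lineDeriv, inner_neg_right]
    ring
  · have he : (fun w : E => max (R - ‖w‖) 0) =ᶠ[𝓝 w] fun w => (0 : ℝ) := by
      filter_upwards [(isOpen_lt continuous_const continuous_norm).mem_nhds h] with x hx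
      have hx' : R < ‖x‖ := hx
      exact max_eq_right (by linarith)
    rw [he.lineDeriv_eq, Set.indicator_of_notMem (by simpa using h.le)]
    exact (hasDerivAt_const (0 : ℝ) (0 : ℝ)).deriv

variable [FiniteDimensional ℝ E]

theorem hasCompactSupport_max_sub_norm (R : ℝ) :
    HasCompactSupport (fun w : E => max (R - ‖w‖) 0) := by
  refine HasCompactSupport.intro (isCompact_closedBall (0 : E) R) fun x hx => ?_
  simp only [Metric.mem_closedBall, dist_zero_right, not_le] at hx
  exact max_eq_right (by linarith)

variable [MeasurableSpace E] [BorelSpace E]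

variable (μ : Measure E) [μ.IsAddHaarMeasure]

theorem continuous_integral_sphere {φ : E → ℝ} (hφ : Continuous φ) (v : E) :
    Continuous fun r : ℝ => ∫ u, φ (r • u.1) * ⟪u.1, v⟫ ∂μ.toSphere := by
  have := continuous_parametric_integral_of_continuous (μ := μ.toSphere) (s := Set.univ)
    (f := fun (r : ℝ) (u : Metric.sphere (0 : E) 1) => φ (r • u.1) * ⟪u.1, v⟫)
    (by fun_prop) isCompact_univ
  simpa using this

variable [Nontrivial E]

theorem ae_norm_ne (R : ℝ) : ∀ᵐ w ∂μ, ‖w‖ ≠ R := by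
  have := Measure.addHaar_sphere μ (0 : E) R
  rw [measure_eq_zero_iff_ae_notMem] at this
  filter_upwards [this] with w hw
  simpa using hw

/-- Integration by parts for Lipschitz functions moves the derivative onto the cone, whose gradient
is `-w / ‖w‖` inside the ball and zero outside. -/
theorem integral_lineDeriv_mul_max_sub_norm {φ : E → ℝ} {C : ℝ≥0} (hφ : LipschitzWith C φ)
    (v : E) (R : ℝ) :
    ∫ w, max (R - ‖w‖) 0 * lineDeriv ℝ φ w v ∂μ =
      ∫ w in Metric.ball 0 R, φ w * (⟪w, v⟫ / ‖w‖) ∂μ := by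
  have h := hφ.integral_lineDeriv_mul_eq (μ := μ) (lipschitzWith_max_sub_norm R)
    (hasCompactSupport_max_sub_norm R) v
  simp_rw [mul_comm (max _ _)]
  rw [h, ← integral_indicator Metric.isOpen_ball.measurableSet]
  refine integral_congr_ae ?_
  filter_upwards [ae_norm_ne μ R, ae_norm_ne μ 0] with w h1 h2
  rw [lineDeriv_max_sub_norm (by simpa using h2) h1]
  by_cases hw : w ∈ Metric.ball (0 : E) R
  · simp only [Set.indicator_of_mem hw]; ring
  · simp only [Set.indicator_of_notMem hw, zero_mul]

/-- In polar coordinates `w = r u` the factor `⟪w, v⟫ / ‖w‖` no longer depends on `r`. This shows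
the ball integral as a primitive in `R`, ready to be differentiated. -/
theorem integral_ball_eq_intervalIntegral {φ : E → ℝ} (hφ : Continuous φ) (v : E) {R : ℝ}
    (hR : 0 ≤ R) :
    ∫ w in Metric.ball 0 R, φ w * (⟪w, v⟫ / ‖w‖) ∂μ =
      ∫ r in (0 : ℝ)..R, r ^ (Module.finrank ℝ E - 1) *
        ∫ u, φ (r • u.1) * ⟪u.1, v⟫ ∂μ.toSphere := by
  have hint : IntegrableOn (fun w => φ w * (⟪w, v⟫ / ‖w‖)) (Metric.ball 0 R) μ := by
    have h1 : IntegrableOn φ (Metric.ball 0 R) μ :=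
      (hφ.continuousOn.integrableOn_compact (isCompact_closedBall 0 R)).mono_set
        Metric.ball_subset_closedBall
    refine Integrable.mul_bdd (c := ‖v‖) h1 ?_ (.of_forall fun w => ?_)
    · exact (Measurable.div (by fun_prop) (by fun_prop)).aestronglyMeasurable
    · rw [norm_div, norm_norm]
      refine div_le_of_le_mul₀ (norm_nonneg _) (norm_nonneg _) ?_
      rw [mul_comm]
      exact norm_inner_le_norm w v
  rw [← integral_indicator Metric.isOpen_ball.measurableSet,
    integral_eq_integral_sphere μ (hint.integrable_indicator Metric.isOpen_ball.measurableSet),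
    intervalIntegral.integral_of_le hR, ← integral_Ioc_eq_integral_Ioo.symm,
    ← integral_indicator measurableSet_Ioi, ← integral_indicator measurableSet_Ioo]
  congr 1
  ext r
  by_cases hr0 : 0 < r
  · rw [Set.indicator_of_mem (by simpa using hr0)]
    by_cases hrR : r < R
    · rw [Set.indicator_of_mem (by exact ⟨hr0, hrR⟩), smul_eq_mul]
      congr 2
      ext u
      rw [Set.indicator_of_mem (by simpa [norm_smul, abs_of_pos hr0] using hrR)]
      simp only [norm_smul, inner_smul_left, norm_eq_of_mem_sphere, Real.norm_eq_abs,
        abs_of_pos hr0]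
      have := hr0.ne'
      simp only [conj_trivial, mul_one]
      field_simp
    · rw [Set.indicator_of_notMem (fun h => hrR h.2)]
      have : ∀ u : Metric.sphere (0 : E) 1, (Metric.ball (0 : E) R).indicator
          (fun w => φ w * (⟪w, v⟫ / ‖w‖)) (r • u.1) = 0 := fun u =>
        Set.indicator_of_notMem (by simpa [norm_smul, abs_of_pos hr0] using hrR) _
      simp [this]
  · rw [Set.indicator_of_notMem (by simpa using hr0),
      Set.indicator_of_notMem (fun h => hr0 h.1)]

theorem hasDerivAt_max_sub {a : ℝ} (ha : a ≠ 1) :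
    HasDerivAt (fun R : ℝ => max (R - a) 0) (if a < 1 then 1 else 0) 1 := by
  rcases lt_or_gt_of_ne ha with h | h
  · rw [if_pos h]
    refine ((hasDerivAt_id (1 : ℝ)).sub_const a).congr_of_eventuallyEq ?_
    filter_upwards [lt_mem_nhds h] with R hR
    simpa using hR.le
  · rw [if_neg h.le.not_gt]
    refine (hasDerivAt_const (1 : ℝ) (0 : ℝ)).congr_of_eventuallyEq ?_
    filter_upwards [gt_mem_nhds h] with R hR
    simpa using hR.le

/-- The divergence theorem on the unit ball for Lipschitz functions. -/
theorem integral_ball_lineDeriv {φ : E → ℝ} {C : ℝ≥0} (hφ : LipschitzWith C φ) (v : E) :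
    ∫ w in Metric.ball 0 1, lineDeriv ℝ φ w v ∂μ = ∫ u, φ u.1 * ⟪u.1, v⟫ ∂μ.toSphere := by
  have hDm : Measurable (fun w => lineDeriv ℝ φ w v) := measurable_lineDeriv hφ.continuous
  have hDb : ∀ w, ‖lineDeriv ℝ φ w v‖ ≤ C * ‖v‖ := fun w => norm_lineDeriv_le_of_lipschitz ℝ hφ
  have hDi : IntegrableOn (fun w => lineDeriv ℝ φ w v) (Metric.ball 0 2) μ :=
    Measure.integrableOn_of_bounded measure_ball_lt_top.ne hDm.aestronglyMeasurable
      (.of_forall hDb)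
  -- Both sides of the cone identity are differentiated in `R` at `1`: the left gives the ball
  -- integral, the right the sphere integral. Radius `2` makes the dominating function integrable
  -- and loses nothing, as the cone vanishes beyond `R < 2`.
  have hP := (hasDerivAt_integral_of_dominated_loc_of_lip
    (μ := μ.restrict (Metric.ball 0 2)) (x₀ := (1 : ℝ)) (s := Set.univ)
    (F := fun (R : ℝ) (w : E) => max (R - ‖w‖) 0 * lineDeriv ℝ φ w v)
    (F' := fun w => (if ‖w‖ < 1 then 1 else 0) * lineDeriv ℝ φ w v)
    (bound := fun w => ‖lineDeriv ℝ φ w v‖) Filter.univ_mem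
    (.of_forall fun R => (Measurable.mul (by fun_prop) hDm).aestronglyMeasurable)
    (hDi.bdd_mul (c := 1) (by fun_prop)
      (.of_forall fun w => by
        rw [Real.norm_eq_abs, abs_of_nonneg (le_max_right _ _)]
        exact max_le (by linarith [norm_nonneg w]) zero_le_one))
    ((Measurable.mul (Measurable.ite (measurableSet_lt measurable_norm measurable_const)
      measurable_const measurable_const) hDm).aestronglyMeasurable)
    (.of_forall fun w => ?_) hDi.norm ?_).2
  rotate_left
  · refine LipschitzOnWith.of_dist_le_mul fun x _ y _ => ?_
    have h1 : LipschitzWith 1 fun R : ℝ => max (R - ‖w‖) 0 :=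
      (LipschitzWith.of_dist_le_mul fun x y => by simp [dist_eq_norm]).max_const 0
    have h2 := h1.dist_le_mul x y
    simp only [dist_eq_norm, NNReal.coe_one, one_mul, Real.coe_nnabs, abs_norm] at h2 ⊢
    rw [← sub_mul, norm_mul, mul_comm]
    gcongr
  · filter_upwards [ae_restrict_of_ae (ae_norm_ne μ 1)] with w hw
    exact (hasDerivAt_max_sub hw).mul_const _
  have hQ : HasDerivAt (fun R : ℝ => ∫ r in (0 : ℝ)..R, r ^ (Module.finrank ℝ E - 1) *
        ∫ u, φ (r • u.1) * ⟪u.1, v⟫ ∂μ.toSphere)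
      (∫ u, φ u.1 * ⟪u.1, v⟫ ∂μ.toSphere) 1 := by
    have hc : Continuous fun r : ℝ => r ^ (Module.finrank ℝ E - 1) *
        ∫ u, φ (r • u.1) * ⟪u.1, v⟫ ∂μ.toSphere :=
      (continuous_pow _).mul (continuous_integral_sphere μ hφ.continuous v)
    have := intervalIntegral.integral_hasDerivAt_right (hc.intervalIntegrable 0 1)
      (hc.stronglyMeasurableAtFilter _ _) hc.continuousAt
    simpa using this
  have hPQ : (fun R : ℝ => ∫ w in Metric.ball 0 2, max (R - ‖w‖) 0 * lineDeriv ℝ φ w v ∂μ)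
      =ᶠ[𝓝 1] fun R : ℝ => ∫ r in (0 : ℝ)..R, r ^ (Module.finrank ℝ E - 1) *
        ∫ u, φ (r • u.1) * ⟪u.1, v⟫ ∂μ.toSphere := by
    filter_upwards [Ioo_mem_nhds zero_lt_one one_lt_two] with R hR
    rw [← integral_ball_eq_intervalIntegral μ hφ.continuous v hR.1.le,
      ← integral_lineDeriv_mul_max_sub_norm μ hφ]
    refine setIntegral_eq_integral_of_forall_compl_eq_zero fun w hw => ?_
    have : 2 ≤ ‖w‖ := by simpa using hw
    rw [max_eq_right (by linarith [hR.2]), zero_mul]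
  rw [← hP.unique (hQ.congr_of_eventuallyEq hPQ),
    ← integral_indicator Metric.isOpen_ball.measurableSet,
    ← integral_indicator Metric.isOpen_ball.measurableSet]
  congr 1
  ext w
  by_cases hw : ‖w‖ < 1
  · have : ‖w‖ < 2 := by linarith
    simp [hw, this]
  · rw [Set.indicator_of_notMem (by simpa using hw)]
    exact (Set.indicator_apply_eq_zero.2 fun _ => by rw [if_neg hw, zero_mul]).symm

end DivergenceTheorem

/-! ### Smoothing a Lipschitz function over a ball, and its gradient. -/

section Smoothing

open scoped RealInnerProductSpace Topology

variable {d : ℕ} {f : EuclideanSpace ℝ (Fin d) → ℝ} {L : ℝ≥0} {δ : ℝ}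

theorem LipschitzWith.comp_add_smul (hL : LipschitzWith L f) (x : EuclideanSpace ℝ (Fin d))
    (δ : ℝ) : LipschitzWith (L * ‖δ‖₊) fun u => f (x + δ • u) :=
  hL.comp (LipschitzWith.of_dist_le_mul fun u v => by
    rw [dist_add_left, dist_smul₀]; rfl)

/-- Rademacher's theorem is applied to the rescaled function itself, so no null set has to be
transported; the affine change of variables is then undone pointwise. -/
theorem LipschitzWith.ae_differentiableAt_add_smul (hL : LipschitzWith L f) (hδ : 0 < δ)
    (x : EuclideanSpace ℝ (Fin d)) :
    ∀ᵐ u ∂(volume : Measure (EuclideanSpace ℝ (Fin d))), DifferentiableAt ℝ f (x + δ • u) := by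
  filter_upwards [(hL.comp_add_smul x δ).ae_differentiableAt] with u hu
  have h1 : f = (fun u => f (x + δ • u)) ∘ fun z => δ⁻¹ • (z - x) := by
    ext z
    simp [smul_smul, hδ.ne']
  rw [h1]
  refine DifferentiableAt.comp _ ?_ (by fun_prop)
  simpa [smul_smul, hδ.ne'] using hu

theorem LipschitzWith.integrable_unifSphere (hd : 1 ≤ d) (hL : LipschitzWith L f)
    (x : EuclideanSpace ℝ (Fin d)) (δ : ℝ) :
    Integrable (fun u => f (x + δ • u) • u) (unifSphere d) := by
  have := isProbabilityMeasure_unifSphere hd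
  have hc := (hL.comp_add_smul x δ)
  refine Integrable.of_bound (hc.continuous.smul continuous_id).aestronglyMeasurable
    (|f x| + L * |δ|) ?_
  filter_upwards [ae_unifSphere_norm] with u hu
  rw [norm_smul, hu, mul_one]
  have h1 := hc.dist_le_mul u 0
  simp only [dist_eq_norm, smul_zero, add_zero, sub_zero, hu, mul_one, NNReal.coe_mul,
    coe_nnnorm, Real.norm_eq_abs] at h1 ⊢
  linarith [abs_sub_abs_le_abs_sub (f (x + δ • u)) (f x)]

theorem LipschitzWith.integrable_unifBall (hL : LipschitzWith L f)
    (x : EuclideanSpace ℝ (Fin d)) (δ : ℝ) :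
    Integrable (fun u => f (x + δ • u)) (unifBall d) := by
  have hc := (hL.comp_add_smul x δ)
  refine Integrable.of_bound hc.continuous.aestronglyMeasurable (|f x| + L * |δ|) ?_
  filter_upwards [ae_unifBall_norm] with u hu
  have h1 := hc.dist_le_mul u 0
  simp only [dist_eq_norm, smul_zero, add_zero, sub_zero, NNReal.coe_mul,
    coe_nnnorm, Real.norm_eq_abs] at h1 ⊢
  have h2 : L * |δ| * ‖u‖ ≤ L * |δ| * 1 := by gcongr
  linarith [abs_sub_abs_le_abs_sub (f (x + δ • u)) (f x)]

/-- The gradient of the smoothed surrogate is a surface integral. -/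
theorem hasGradientAt_smoothedSurrogate (hd : 1 ≤ d) (hL : LipschitzWith L f) (hδ : 0 < δ)
    (x : EuclideanSpace ℝ (Fin d)) :
    HasGradientAt (smoothedSurrogate f δ)
      (((d : ℝ) / δ) • ∫ u, f (x + δ • u) • u ∂(unifSphere d)) x := by
  have : Nonempty (Fin d) := ⟨⟨0, hd⟩⟩
  have hdiff := hL.ae_differentiableAt_add_smul hδ x
  obtain ⟨hi, hF⟩ := hasFDerivAt_integral_of_dominated_loc_of_lip
    (μ := unifBall d) (x₀ := x) (s := Set.univ)
    (F := fun y u => f (y + δ • u)) (F' := fun u => fderiv ℝ f (x + δ • u))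
    (bound := fun _ => (L : ℝ)) Filter.univ_mem
    (.of_forall fun y => (hL.comp_add_smul y δ).continuous.aestronglyMeasurable)
    (hL.integrable_unifBall x δ)
    ((measurable_fderiv ℝ f).comp (by fun_prop)).aestronglyMeasurable
    (.of_forall fun u => by
      simp only [Real.nnabs_of_nonneg (NNReal.coe_nonneg L), Real.toNNReal_coe]
      exact (LipschitzWith.of_dist_le_mul fun y z => by
        simpa using hL.dist_le_mul (y + δ • u) (z + δ • u)).lipschitzOnWith)
    (integrable_const _)
    (unifBall_absolutelyContinuous.ae_le (hdiff.mono fun u hu => by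
      have h1 : HasFDerivAt (fun y => y + δ • u)
        (ContinuousLinearMap.id ℝ (EuclideanSpace ℝ (Fin d))) x :=
          (hasFDerivAt_id x).add_const _
      simpa [Function.comp_def] using hu.hasFDerivAt.comp x h1))
  rw [hasGradientAt_iff_hasFDerivAt]
  convert! hF using 1
  ext v
  rw [InnerProductSpace.toDual_apply_apply, real_inner_smul_left,
    ContinuousLinearMap.integral_apply hi v, real_inner_comm,
    ← integral_inner (hL.integrable_unifSphere hd x δ)]
  -- The chain rule trades the derivative in `x` for one in `u` at the cost of `δ⁻¹`, so that the
  -- divergence theorem applies.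
  have h1 : ∫ u, fderiv ℝ f (x + δ • u) v ∂(unifBall d) =
      ∫ u, δ⁻¹ * lineDeriv ℝ (fun u => f (x + δ • u)) u v ∂(unifBall d) := by
    refine integral_congr_ae (unifBall_absolutelyContinuous.ae_le (hdiff.mono fun u hu => ?_))
    have h1 : HasFDerivAt (fun u => x + δ • u)
        (δ • ContinuousLinearMap.id ℝ (EuclideanSpace ℝ (Fin d))) u :=
      ((hasFDerivAt_id u).const_smul δ).const_add x
    have h2 := (hu.hasFDerivAt.comp u h1).hasLineDerivAt v
    have h3 := h2.lineDeriv
    simp only [Function.comp_def] at h3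
    dsimp only
    rw [h3]
    simp [hδ.ne']
  have hd0 : (d : ℝ) ≠ 0 := by positivity
  have hv := (volume_ball_pos (d := d)).ne'
  rw [h1, integral_const_mul, integral_unifBall,
    integral_ball_lineDeriv volume (hL.comp_add_smul x δ), integral_unifSphere]
  simp only [inner_smul_right, real_inner_comm v, smul_eq_mul]
  field_simp

theorem gradient_smoothedSurrogate (hd : 1 ≤ d) (hL : LipschitzWith L f) (hδ : 0 < δ)
    (x : EuclideanSpace ℝ (Fin d)) :
    gradient (smoothedSurrogate f δ) x =
      ((d : ℝ) / δ) • ∫ u, f (x + δ • u) • u ∂(unifSphere d) :=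
  (hasGradientAt_smoothedSurrogate hd hL hδ x).gradient

/-- Smoothing the constant `1` gives a constant, so the gradient formula, which reduces to a
multiple of this mean, must vanish. -/
theorem integral_id_unifSphere (hd : 1 ≤ d) : ∫ u, u ∂(unifSphere d) = 0 := by
  have h1 := hasGradientAt_smoothedSurrogate hd
    (LipschitzWith.const (1 : ℝ) : LipschitzWith 0 fun _ : EuclideanSpace ℝ (Fin d) => (1 : ℝ))
    one_pos 0
  have h2 : smoothedSurrogate (fun _ : EuclideanSpace ℝ (Fin d) => (1 : ℝ)) 1 = fun _ => 1 := by
    ext x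
    simp [smoothedSurrogate]
  rw [h2] at h1
  have h3 := h1.unique (hasGradientAt_const 0 (1 : ℝ))
  have hd0 : (d : ℝ) ≠ 0 := by positivity
  simpa [hd0] using h3

/-- In the surface integral formula `x` enters only through `f`, so the gradient is even Lipschitz
in `x`. -/
theorem continuous_gradient_smoothedSurrogate (hd : 1 ≤ d) (hL : LipschitzWith L f)
    (hδ : 0 < δ) : Continuous (gradient (smoothedSurrogate f δ)) := by
  have := isProbabilityMeasure_unifSphere hd
  rw [show gradient (smoothedSurrogate f δ) = _ from
    funext (gradient_smoothedSurrogate hd hL hδ)]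
  have hlip : LipschitzWith L fun x => ∫ u, f (x + δ • u) • u ∂(unifSphere d) := by
    refine LipschitzWith.of_dist_le_mul fun x y => ?_
    rw [dist_eq_norm, ← integral_sub (hL.integrable_unifSphere hd x δ)
      (hL.integrable_unifSphere hd y δ)]
    refine (norm_integral_le_of_norm_le_const (C := L * dist x y) ?_).trans (by simp)
    filter_upwards [ae_unifSphere_norm] with u hu
    rw [← sub_smul, norm_smul, hu, mul_one]
    simpa [dist_eq_norm] using hL.dist_le_mul (x + δ • u) (y + δ • u)
  exact hlip.continuous.const_smul ((d : ℝ) / δ)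

theorem lipschitzWith_smoothedSurrogate (hL : LipschitzWith L f) (δ : ℝ) :
    LipschitzWith L (smoothedSurrogate f δ) := by
  refine LipschitzWith.of_dist_le_mul fun x y => ?_
  simp only [smoothedSurrogate]
  rw [dist_eq_norm, ← integral_sub (hL.integrable_unifBall x δ) (hL.integrable_unifBall y δ)]
  refine (norm_integral_le_of_norm_le_const (C := L * dist x y)
    (.of_forall fun u => ?_)).trans (by simp)
  simpa [dist_eq_norm] using hL.dist_le_mul (x + δ • u) (y + δ • u)

theorem abs_smoothedSurrogate_sub_le (hL : LipschitzWith L f) (hδ : 0 ≤ δ)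
    (x : EuclideanSpace ℝ (Fin d)) : |smoothedSurrogate f δ x - f x| ≤ L * δ := by
  have h1 : smoothedSurrogate f δ x - f x = ∫ u, (f (x + δ • u) - f x) ∂(unifBall d) := by
    rw [integral_sub (hL.integrable_unifBall x δ) (integrable_const _)]
    simp [smoothedSurrogate]
  rw [h1, ← Real.norm_eq_abs]
  refine (norm_integral_le_of_norm_le_const (C := L * δ) ?_).trans (by simp)
  filter_upwards [ae_unifBall_norm] with u hu
  have h2 := hL.dist_le_mul (x + δ • u) x
  simp only [dist_eq_norm, add_sub_cancel_left, norm_smul, Real.norm_eq_abs,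
    abs_of_nonneg hδ] at h2 ⊢
  refine h2.trans ?_
  gcongr
  nlinarith

end Smoothing

/-! ### The direction of a Gaussian vector is uniform on the sphere. -/

section GaussianDirection

open scoped RealInnerProductSpace

variable {d : ℕ}

/-- The direction of a vector with a radial density is uniform on the sphere. -/
theorem map_inv_norm_smul_withDensity (hd : 1 ≤ d) {ρ : ℝ → ℝ≥0∞} (hρ : Measurable ρ)
    [IsProbabilityMeasure
      ((volume : Measure (EuclideanSpace ℝ (Fin d))).withDensity fun x => ρ ‖x‖)] :
    ((volume : Measure (EuclideanSpace ℝ (Fin d))).withDensity fun x => ρ ‖x‖).map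
      (fun x => ‖x‖⁻¹ • x) = unifSphere d := by
  have : Nonempty (Fin d) := ⟨⟨0, hd⟩⟩
  set ν := (volume : Measure (EuclideanSpace ℝ (Fin d))).withDensity fun x => ρ ‖x‖ with hν
  set τ := (volume : Measure (EuclideanSpace ℝ (Fin d))).toSphere with hτ
  set K := ∫⁻ r, ρ r.1 ∂(Measure.volumeIoiPow
    (Module.finrank ℝ (EuclideanSpace ℝ (Fin d)) - 1)) with hK
  have hT : Measurable fun x : EuclideanSpace ℝ (Fin d) => ‖x‖⁻¹ • x := by fun_prop
  -- In polar coordinates the density sees only `r` and the event only `u`, so the mass factors. The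
  -- radial factor `K` need not be computed: total mass one determines it.
  have key : ∀ A : Set (EuclideanSpace ℝ (Fin d)), MeasurableSet A →
      ν.map (fun x => ‖x‖⁻¹ • x) A = τ (Subtype.val ⁻¹' A) * K := by
    intro A hA
    have hmp := measurePreserving_smul_sphere (volume : Measure (EuclideanSpace ℝ (Fin d)))
    have hTA := hT hA
    rw [Measure.map_apply hT hA, hν, withDensity_apply _ hTA, ← lintegral_indicator hTA]
    conv_lhs => rw [← hmp.map_eq]
    rw [lintegral_map (Measurable.indicator (by fun_prop) hTA) hmp.measurable]
    have hA' : MeasurableSet (Subtype.val ⁻¹' A :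
      Set (Metric.sphere (0 : EuclideanSpace ℝ (Fin d)) 1)) := measurable_subtype_coe hA
    rw [hK, ← lintegral_indicator_one hA', ← lintegral_prod_mul
      (measurable_one.indicator hA').aemeasurable (by fun_prop)]
    refine lintegral_congr fun p => ?_
    have hp := p.2.2
    have hr : (0 : ℝ) < p.2.1 := hp
    have h1 : ‖p.2.1 • p.1.1‖ = p.2.1 := by simp [norm_smul, abs_of_pos hr]
    by_cases hpA : p.1.1 ∈ A
    · rw [Set.indicator_of_mem, Set.indicator_of_mem, h1]
      · simp
      · exact hpA
      · simpa [smul_smul, h1, norm_smul, abs_of_pos hr, hr.ne'] using hpA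
    · rw [Set.indicator_of_notMem, Set.indicator_of_notMem, zero_mul]
      · exact hpA
      · simpa [smul_smul, h1, norm_smul, abs_of_pos hr, hr.ne'] using hpA
  have h1 : τ Set.univ * K = 1 := by
    rw [← Set.preimage_univ (f := Subtype.val), ← key _ .univ,
      Measure.map_apply hT .univ, Set.preimage_univ, measure_univ]
  have h2 : K = (τ Set.univ)⁻¹ := ENNReal.eq_inv_of_mul_eq_one_left (by rwa [mul_comm])
  ext A hA
  rw [key A hA, unifSphere, Measure.smul_apply, Measure.map_apply measurable_subtype_coe hA,
    h2, smul_eq_mul, mul_comm]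

/-- Both measures have the same characteristic function, by the Fourier transform of the Gaussian.
The constant stays existential because only the radial shape of the density is used. -/
theorem stdGaussian_eq_withDensity :
    ∃ c : ℝ, stdGaussian (EuclideanSpace ℝ (Fin d)) =
      (volume : Measure (EuclideanSpace ℝ (Fin d))).withDensity
        fun x => ENNReal.ofReal (c * Real.exp (-(1 / 2) * ‖x‖ ^ 2)) := by
  have hb : (0 : ℝ) < ((1 / 2 : ℂ)).re := by norm_num
  have hcast : ∀ x : EuclideanSpace ℝ (Fin d),
      ((Real.exp (-(1 / 2) * ‖x‖ ^ 2) : ℝ) : ℂ) = Complex.exp (-(1 / 2) * ‖x‖ ^ 2) := by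
    intro x; push_cast; rfl
  have hint : Integrable fun x : EuclideanSpace ℝ (Fin d) =>
      Real.exp (-(1 / 2) * ‖x‖ ^ 2) := by
    have h := GaussianFourier.integrable_cexp_neg_mul_sq_norm_add hb 0
      (0 : EuclideanSpace ℝ (Fin d))
    have h' := h.re
    refine h'.congr (.of_forall fun x => ?_)
    have := hcast x
    simp only [inner_zero_left, Complex.ofReal_zero, mul_zero, add_zero]
    rw [← this]
    exact Complex.ofReal_re _
  set Z := ∫ x : EuclideanSpace ℝ (Fin d), Real.exp (-(1 / 2) * ‖x‖ ^ 2) with hZ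
  have hZpos : 0 < Z := integral_exp_pos hint
  refine ⟨Z⁻¹, ?_⟩
  set ν := (volume : Measure (EuclideanSpace ℝ (Fin d))).withDensity
        fun x => ENNReal.ofReal (Z⁻¹ * Real.exp (-(1 / 2) * ‖x‖ ^ 2)) with hν
  have hνi : ∀ G : EuclideanSpace ℝ (Fin d) → ℂ, ∫ x, G x ∂ν =
      (Z : ℂ)⁻¹ * ∫ x, Complex.exp (-(1 / 2) * ‖x‖ ^ 2) * G x := by
    intro G
    rw [hν, integral_withDensity_eq_integral_toReal_smul (by fun_prop)
      (.of_forall fun _ => ENNReal.ofReal_lt_top), ← integral_const_mul]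
    refine integral_congr_ae (.of_forall fun x => ?_)
    dsimp only
    rw [ENNReal.toReal_ofReal (by positivity), ← hcast, Complex.real_smul]
    push_cast
    ring
  have hfin : IsFiniteMeasure ν :=
    isFiniteMeasure_withDensity_ofReal (hint.const_mul _).2
  refine Measure.ext_of_charFun ?_
  ext t
  rw [charFun_stdGaussian, charFun_apply, hνi]
  have h1 := GaussianFourier.integral_cexp_neg_mul_sq_norm_add hb Complex.I t
  have h2 := GaussianFourier.integral_cexp_neg_mul_sq_norm (V := EuclideanSpace ℝ (Fin d)) hb
  have h3 : (Z : ℂ) = ∫ x : EuclideanSpace ℝ (Fin d), Complex.exp (-(1 / 2) * ‖x‖ ^ 2) := by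
    rw [hZ, ← integral_complex_ofReal]
    simp only [hcast]
  have h4 : ∀ x : EuclideanSpace ℝ (Fin d), Complex.exp (-(1 / 2) * ‖x‖ ^ 2) *
      Complex.exp (⟪x, t⟫ * Complex.I) =
      Complex.exp (-(1 / 2) * ‖x‖ ^ 2 + Complex.I * ⟪t, x⟫) := by
    intro x
    rw [← Complex.exp_add, real_inner_comm, mul_comm Complex.I]
  simp_rw [h4]
  rw [h1, ← h2, ← h3, inv_mul_cancel_left₀ (by exact_mod_cast hZpos.ne')]
  congr 1
  rw [Complex.I_sq]
  ring

theorem map_inv_norm_smul_stdGaussian (hd : 1 ≤ d) :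
    (stdGaussian (EuclideanSpace ℝ (Fin d))).map (fun x => ‖x‖⁻¹ • x) = unifSphere d := by
  obtain ⟨c, hc⟩ := stdGaussian_eq_withDensity (d := d)
  have hp : IsProbabilityMeasure (stdGaussian (EuclideanSpace ℝ (Fin d))) := inferInstance
  rw [hc] at hp ⊢
  exact map_inv_norm_smul_withDensity hd
    (ρ := fun r => ENNReal.ofReal (c * Real.exp (-(1 / 2) * r ^ 2))) (by fun_prop)

end GaussianDirection

theorem Real.enorm_sq_eq_ofReal (a : ℝ) : ‖a‖ₑ ^ 2 = ENNReal.ofReal (a ^ 2) := by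
  rw [Real.enorm_eq_ofReal_abs, ← ENNReal.ofReal_pow (abs_nonneg a), sq_abs]

theorem enorm_sq_eq_ofReal_norm {F : Type*} [NormedAddCommGroup F] (a : F) :
    ‖a‖ₑ ^ 2 = ENNReal.ofReal (‖a‖ ^ 2) := by
  rw [← ofReal_norm, ← ENNReal.ofReal_pow (norm_nonneg a)]

/-- Cauchy–Schwarz, from integrating the nonnegative function `((b - a) g - m) ^ 2` with `m` the
integral of `g`. -/
theorem sq_intervalIntegral_le {g : ℝ → ℝ} (hg : Continuous g) {a b : ℝ} (hab : a < b) :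
    (∫ t in a..b, g t) ^ 2 ≤ (b - a) * ∫ t in a..b, g t ^ 2 := by
  set m := ∫ t in a..b, g t with hm
  have h0 : 0 ≤ ∫ t in a..b, ((b - a) * g t - m) ^ 2 :=
    intervalIntegral.integral_nonneg hab.le fun t _ => sq_nonneg _
  have h1 : ∫ t in a..b, ((b - a) * g t - m) ^ 2 =
      (b - a) * ((b - a) * (∫ t in a..b, g t ^ 2) - m ^ 2) := by
    have : ∀ t, ((b - a) * g t - m) ^ 2 =
        (b - a) ^ 2 * g t ^ 2 - 2 * (b - a) * m * g t + m ^ 2 := fun t => by ring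
    simp_rw [this]
    rw [intervalIntegral.integral_add, intervalIntegral.integral_sub,
      intervalIntegral.integral_const_mul, intervalIntegral.integral_const_mul,
      intervalIntegral.integral_const, ← hm, smul_eq_mul]
    · ring
    all_goals exact Continuous.intervalIntegrable (by fun_prop) _ _
  rw [h1] at h0
  have := nonneg_of_mul_nonneg_right h0 (sub_pos.2 hab)
  linarith

/-! ### Gaussian Poincaré inequality for smooth functions. -/

section GaussianPoincare

theorem continuous_rotation {E : Type*} [NormedAddCommGroup E] [NormedSpace ℝ E] :
    Continuous fun q : ℝ × (E × E) => ContinuousLinearMap.rotation q.1 q.2 := by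
  simp only [ContinuousLinearMap.rotation_apply]
  fun_prop

variable {E : Type*} [NormedAddCommGroup E] [InnerProductSpace ℝ E] [FiniteDimensional ℝ E]
  [MeasurableSpace E] [BorelSpace E]

theorem integral_sq_dual_stdGaussian (A : StrongDual ℝ E) :
    ∫ y, A y ^ 2 ∂(stdGaussian E) = ‖A‖ ^ 2 := by
  have h := variance_dual_stdGaussian A
  rw [variance_eq_integral A.continuous.aemeasurable, integral_strongDual_stdGaussian] at h
  simpa only [sub_zero] using h

theorem lintegral_enorm_sq_dual_stdGaussian (A : StrongDual ℝ E) :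
    ∫⁻ y, ‖A y‖ₑ ^ 2 ∂(stdGaussian E) = ‖A‖ₑ ^ 2 := by
  simp_rw [Real.enorm_sq_eq_ofReal]
  rw [← ofReal_integral_eq_lintegral_ofReal _ (.of_forall fun y => sq_nonneg _),
    integral_sq_dual_stdGaussian, enorm_sq_eq_ofReal_norm]
  exact (IsGaussian.memLp_dual _ A 2 (by simp)).integrable_sq

/-- The Gaussian Poincaré inequality (with a non-sharp constant), by rotation of two independent
copies. -/
theorem lintegral_enorm_sub_sq_stdGaussian_of_contDiff {h : E → ℝ} {L : ℝ≥0}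
    (hh : ContDiff ℝ 1 h) (hL : LipschitzWith L h) :
    ∫⁻ p, ‖h p.1 - h p.2‖ₑ ^ 2 ∂((stdGaussian E).prod (stdGaussian E)) ≤
      ENNReal.ofReal (Real.pi ^ 2 / 4 * L ^ 2) := by
  set γ := stdGaussian E
  have hD : Differentiable ℝ h := hh.differentiable one_ne_zero
  have hDc : Continuous (fderiv ℝ h) := hh.continuous_fderiv one_ne_zero
  obtain ⟨D, hDdef⟩ : ∃ D : E × E → ℝ, ∀ p, D p = fderiv ℝ h p.1 p.2 := ⟨_, fun _ => rfl⟩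
  have hDcont : Continuous D := by
    rw [funext hDdef]
    exact (hDc.comp continuous_fst).clm_apply continuous_snd
  have hDrot : Continuous fun q : ℝ × (E × E) => D (ContinuousLinearMap.rotation q.1 q.2) :=
    hDcont.comp continuous_rotation
  have hpi : (0 : ℝ) < Real.pi / 2 := by positivity
  -- Rotating the pair by `θ` from `0` to `π / 2` carries the first component from `p.1` to `p.2`,
  -- with the second component as its velocity. The fundamental theorem of calculus and
  -- Cauchy–Schwarz along this path give the bound.
  have hpt : ∀ p : E × E, ‖h p.1 - h p.2‖ₑ ^ 2 ≤ ENNReal.ofReal (Real.pi / 2) *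
      ∫⁻ θ in Set.Ioc 0 (Real.pi / 2), ‖D (ContinuousLinearMap.rotation θ p)‖ₑ ^ 2 := by
    intro p
    have h0 : Continuous fun θ : ℝ => ContinuousLinearMap.rotation θ p := by
      simp only [ContinuousLinearMap.rotation_apply]
      fun_prop
    have hc : Continuous fun θ : ℝ => D (ContinuousLinearMap.rotation θ p) :=
      hDcont.comp h0
    have hder : ∀ θ : ℝ, HasDerivAt (fun θ => h (ContinuousLinearMap.rotation θ p).1)
        (D (ContinuousLinearMap.rotation θ p)) θ := by
      intro θ
      have h1 : HasDerivAt (fun θ : ℝ => (ContinuousLinearMap.rotation θ p).1)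
          (ContinuousLinearMap.rotation θ p).2 θ := by
        simp only [ContinuousLinearMap.rotation_apply]
        exact ((Real.hasDerivAt_cos θ).smul_const _).add ((Real.hasDerivAt_sin θ).smul_const _)
      rw [hDdef]
      exact (hD _).hasFDerivAt.comp_hasDerivAt θ h1
    have hftc := intervalIntegral.integral_eq_sub_of_hasDerivAt (a := 0) (b := Real.pi / 2)
      (fun θ _ => hder θ) (hc.intervalIntegrable _ _)
    have hcs := sq_intervalIntegral_le hc hpi
    rw [hftc] at hcs
    simp only [ContinuousLinearMap.rotation_apply, Real.cos_pi_div_two, Real.sin_pi_div_two,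
      Real.cos_zero, Real.sin_zero, zero_smul, one_smul, zero_add, add_zero, sub_zero] at hcs
    simp_rw [Real.enorm_sq_eq_ofReal]
    rw [← ofReal_integral_eq_lintegral_ofReal _ (.of_forall fun y => sq_nonneg _),
      ← ENNReal.ofReal_mul hpi.le, ← intervalIntegral.integral_of_le hpi.le]
    · refine ENNReal.ofReal_le_ofReal ?_
      rw [← neg_sq, neg_sub]
      exact hcs
    · exact ((hc.pow 2).intervalIntegrable 0 (Real.pi / 2)).1
  calc ∫⁻ p, ‖h p.1 - h p.2‖ₑ ^ 2 ∂(γ.prod γ)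
      ≤ ∫⁻ p, (ENNReal.ofReal (Real.pi / 2) * ∫⁻ θ in Set.Ioc 0 (Real.pi / 2),
          ‖D (ContinuousLinearMap.rotation θ p)‖ₑ ^ 2) ∂(γ.prod γ) := lintegral_mono hpt
    _ = ENNReal.ofReal (Real.pi / 2) * ∫⁻ θ in Set.Ioc 0 (Real.pi / 2),
          ∫⁻ p, ‖D (ContinuousLinearMap.rotation θ p)‖ₑ ^ 2 ∂(γ.prod γ) := by
        rw [lintegral_const_mul' _ _ ENNReal.ofReal_ne_top, lintegral_lintegral_swap]
        exact ((hDrot.comp continuous_swap).measurable.enorm.pow_const 2).aemeasurable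
    _ ≤ ENNReal.ofReal (Real.pi / 2) * ∫⁻ θ in Set.Ioc 0 (Real.pi / 2),
          ENNReal.ofReal ((L : ℝ) ^ 2) := by
        gcongr with θ
        -- The product Gaussian is rotation invariant, so `θ` disappears. Velocity and position are
        -- then independent, and averaging over the velocity leaves `‖fderiv ℝ h x‖ ^ 2 ≤ L ^ 2`.
        have hrot := IsGaussian.map_rotation_eq_self (μ := γ) integral_id_stdGaussian θ
        rw [← lintegral_map (f := fun p => ‖D p‖ₑ ^ 2) (by fun_prop) (by fun_prop), hrot,
          lintegral_prod _ (by fun_prop)]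
        refine (lintegral_mono (g := fun _ => ENNReal.ofReal ((L : ℝ) ^ 2)) fun x => ?_).trans
          (by simp)
        simp_rw [hDdef]
        rw [lintegral_enorm_sq_dual_stdGaussian, enorm_sq_eq_ofReal_norm]
        gcongr
        exact norm_fderiv_le_of_lipschitz ℝ hL
    _ = ENNReal.ofReal (Real.pi ^ 2 / 4 * L ^ 2) := by
        rw [setLIntegral_const, Real.volume_Ioc, sub_zero, ← ENNReal.ofReal_mul (by positivity),
          ← ENNReal.ofReal_mul hpi.le]
        congr 1
        ring

end GaussianPoincare

/-! ### Gaussian Poincaré inequality for Lipschitz functions, and the Gaussian second moment. -/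

section GaussianLipschitz

variable {d : ℕ}

theorem contDiff_smoothedSurrogate {f : EuclideanSpace ℝ (Fin d) → ℝ} {L : ℝ≥0} {δ : ℝ}
    (hd : 1 ≤ d) (hL : LipschitzWith L f) (hδ : 0 < δ) :
    ContDiff ℝ 1 (smoothedSurrogate f δ) := by
  have hg := fun x => (hasGradientAt_smoothedSurrogate hd hL hδ x)
  have hc := continuous_gradient_smoothedSurrogate hd hL hδ
  rw [contDiff_one_iff_fderiv]
  refine ⟨fun x => (hg x).differentiableAt, ?_⟩
  have : fderiv ℝ (smoothedSurrogate f δ) = fun x =>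
      InnerProductSpace.toDual ℝ _ (gradient (smoothedSurrogate f δ) x) := by
    ext x : 1
    rw [(hg x).gradient]
    exact (hg x).hasFDerivAt.fderiv
  rw [this]
  exact (InnerProductSpace.toDual ℝ _).continuous.comp hc

theorem lintegral_enorm_sub_sq_stdGaussian (hd : 1 ≤ d) {h : EuclideanSpace ℝ (Fin d) → ℝ}
    {L : ℝ≥0} (hL : LipschitzWith L h) :
    ∫⁻ p, ‖h p.1 - h p.2‖ₑ ^ 2 ∂((stdGaussian (EuclideanSpace ℝ (Fin d))).prod
      (stdGaussian (EuclideanSpace ℝ (Fin d)))) ≤ ENNReal.ofReal (5 * L ^ 2) := by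
  -- Smoothing at radius `1 / 20` moves `h` by at most `L / 20`. The total constant is then `π ^ 2 /
  -- 2 + 1 / 50`, just below `5`.
  have hε : (0 : ℝ) < 1 / 20 := by norm_num
  have hsm := lintegral_enorm_sub_sq_stdGaussian_of_contDiff
    (contDiff_smoothedSurrogate hd hL hε) (lipschitzWith_smoothedSurrogate hL (1 / 20))
  set k := smoothedSurrogate h (1 / 20) with hk
  have hpt : ∀ p : EuclideanSpace ℝ (Fin d) × EuclideanSpace ℝ (Fin d),
      ‖h p.1 - h p.2‖ₑ ^ 2 ≤ 2 * ‖k p.1 - k p.2‖ₑ ^ 2 + ENNReal.ofReal (L ^ 2 / 50) := by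
    intro p
    rw [Real.enorm_sq_eq_ofReal, Real.enorm_sq_eq_ofReal, ← ENNReal.ofReal_ofNat,
      ← ENNReal.ofReal_mul (by norm_num), ← ENNReal.ofReal_add (by positivity) (by positivity)]
    refine ENNReal.ofReal_le_ofReal ?_
    have h1 := abs_le.1 (abs_smoothedSurrogate_sub_le hL hε.le p.1)
    have h2 := abs_le.1 (abs_smoothedSurrogate_sub_le hL hε.le p.2)
    rw [← hk] at h1 h2
    have h3 : ((h p.1 - k p.1) - (h p.2 - k p.2)) ^ 2 ≤ (L / 10 : ℝ) ^ 2 := by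
      apply sq_le_sq' <;> linarith [h1.1, h1.2, h2.1, h2.2]
    nlinarith [sq_nonneg ((k p.1 - k p.2) - ((h p.1 - k p.1) - (h p.2 - k p.2)))]
  refine (lintegral_mono hpt).trans ?_
  rw [lintegral_add_right _ measurable_const, lintegral_const_mul' _ _ ENNReal.ofNat_ne_top]
  simp only [lintegral_const, measure_univ, mul_one]
  refine (add_le_add_left (mul_le_mul_right hsm 2) _).trans ?_
  rw [← ENNReal.ofReal_ofNat, ← ENNReal.ofReal_mul (by norm_num),
    ← ENNReal.ofReal_add (by positivity) (by positivity)]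
  refine ENNReal.ofReal_le_ofReal ?_
  have hpi : Real.pi ^ 2 ≤ 9.93 := by nlinarith [Real.pi_lt_d2, Real.pi_pos]
  nlinarith [sq_nonneg (L : ℝ)]

theorem integral_norm_sq_stdGaussian :
    ∫ x, ‖x‖ ^ 2 ∂(stdGaussian (EuclideanSpace ℝ (Fin d))) = d := by
  have h1 : ∀ (i : Fin d), ∫ x, (EuclideanSpace.proj (𝕜 := ℝ) i x) ^ 2
      ∂(stdGaussian (EuclideanSpace ℝ (Fin d))) = 1 := by
    intro i
    have hA : (EuclideanSpace.proj (𝕜 := ℝ) i : EuclideanSpace ℝ (Fin d) →L[ℝ] ℝ) =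
        InnerProductSpace.toDual ℝ _ (EuclideanSpace.single i (1 : ℝ)) := by
      ext x
      simp [EuclideanSpace.inner_single_left]
    rw [integral_sq_dual_stdGaussian, hA]
    simp
  simp_rw [EuclideanSpace.real_norm_sq_eq]
  rw [integral_finsetSum]
  · have : ∀ i : Fin d, ∫ x : EuclideanSpace ℝ (Fin d), x i ^ 2
      ∂(stdGaussian (EuclideanSpace ℝ (Fin d))) = 1 := h1
    simp [this]
  · intro i _
    exact (IsGaussian.memLp_dual _ (EuclideanSpace.proj (𝕜 := ℝ) i) 2 (by simp)).integrable_sq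

end GaussianLipschitz

/-! ### Concentration on the sphere, transferred from the Gaussian. -/

section SphereVariance

variable {d : ℕ}

theorem integrable_norm_stdGaussian :
    Integrable (fun x => ‖x‖) (stdGaussian (EuclideanSpace ℝ (Fin d))) :=
  IsGaussian.integrable_id.norm

theorem integrable_norm_sq_stdGaussian :
    Integrable (fun x => ‖x‖ ^ 2) (stdGaussian (EuclideanSpace ℝ (Fin d))) :=
  IsGaussian.memLp_two_id.integrable_norm_pow two_ne_zero

/-- The left side is the variance of the norm. The mean squared difference of two independent copies
is twice the variance, and the Poincaré bound for the `1`-Lipschitz norm is `5`. -/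
theorem sub_sq_integral_norm_stdGaussian_le (hd : 1 ≤ d) :
    d - (∫ x, ‖x‖ ∂(stdGaussian (EuclideanSpace ℝ (Fin d)))) ^ 2 ≤ 5 / 2 := by
  have h1 := lintegral_enorm_sub_sq_stdGaussian hd
    (lipschitzWith_one_norm (E := EuclideanSpace ℝ (Fin d)))
  set γ := stdGaussian (EuclideanSpace ℝ (Fin d))
  have i1 : Integrable (fun x => ‖x‖) γ := integrable_norm_stdGaussian
  have i2 : Integrable (fun x => ‖x‖ ^ 2) γ := integrable_norm_sq_stdGaussian
  have hexp : ∀ p : EuclideanSpace ℝ (Fin d) × EuclideanSpace ℝ (Fin d),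
      (‖p.1‖ - ‖p.2‖) ^ 2 = ‖p.1‖ ^ 2 + ‖p.2‖ ^ 2 - 2 * (‖p.1‖ * ‖p.2‖) := fun p => by ring
  have j1 : Integrable (fun p : EuclideanSpace ℝ (Fin d) × EuclideanSpace ℝ (Fin d) =>
    ‖p.1‖ ^ 2) (γ.prod γ) := i2.comp_fst γ
  have j2 : Integrable (fun p : EuclideanSpace ℝ (Fin d) × EuclideanSpace ℝ (Fin d) =>
    ‖p.2‖ ^ 2) (γ.prod γ) := i2.comp_snd γ
  have j3 : Integrable (fun p : EuclideanSpace ℝ (Fin d) × EuclideanSpace ℝ (Fin d) =>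
    2 * (‖p.1‖ * ‖p.2‖)) (γ.prod γ) := (i1.mul_prod i1).const_mul 2
  have j12 : Integrable (fun p : EuclideanSpace ℝ (Fin d) × EuclideanSpace ℝ (Fin d) =>
    ‖p.1‖ ^ 2 + ‖p.2‖ ^ 2) (γ.prod γ) := j1.add j2
  simp_rw [Real.enorm_sq_eq_ofReal] at h1
  rw [← ofReal_integral_eq_lintegral_ofReal _ (.of_forall fun y => sq_nonneg _),
    ENNReal.ofReal_le_ofReal_iff (by positivity)] at h1
  · simp_rw [hexp] at h1
    rw [integral_sub j12 j3, integral_add j1 j2, integral_const_mul,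
      integral_prod_mul, integral_fun_fst (fun x : EuclideanSpace ℝ (Fin d) => ‖x‖ ^ 2),
      integral_fun_snd (fun x : EuclideanSpace ℝ (Fin d) => ‖x‖ ^ 2),
      integral_norm_sq_stdGaussian] at h1
    simp only [probReal_univ, one_smul, NNReal.coe_one] at h1
    linarith
  · simp_rw [hexp]
    exact j12.sub j3

theorem lintegral_sq_norm_sub_mean_stdGaussian_le (hd : 1 ≤ d) :
    ∫⁻ x, ENNReal.ofReal
      ((‖x‖ - ∫ y, ‖y‖ ∂(stdGaussian (EuclideanSpace ℝ (Fin d)))) ^ 2)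
      ∂(stdGaussian (EuclideanSpace ℝ (Fin d))) ≤ ENNReal.ofReal (5 / 2) := by
  have h1 := sub_sq_integral_norm_stdGaussian_le hd
  set m := ∫ y, ‖y‖ ∂(stdGaussian (EuclideanSpace ℝ (Fin d))) with hm
  have hexp : ∀ x : EuclideanSpace ℝ (Fin d),
      (‖x‖ - m) ^ 2 = ‖x‖ ^ 2 - 2 * m * ‖x‖ + m ^ 2 := fun p => by ring
  have i1 := integrable_norm_sq_stdGaussian (d := d)
  have i2 := (integrable_norm_stdGaussian (d := d)).const_mul (2 * m)
  have i12 : Integrable (fun x => ‖x‖ ^ 2 - 2 * m * ‖x‖)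
    (stdGaussian (EuclideanSpace ℝ (Fin d))) := i1.sub i2
  rw [← ofReal_integral_eq_lintegral_ofReal _ (.of_forall fun y => sq_nonneg _)]
  · refine ENNReal.ofReal_le_ofReal ?_
    simp_rw [hexp]
    rw [integral_add i12 (integrable_const _), integral_sub i1 i2, integral_const_mul,
      integral_norm_sq_stdGaussian, ← hm]
    simp only [integral_const, probReal_univ, one_smul]
    linarith
  · simp_rw [hexp]
    exact i12.add (integrable_const _)

theorem norm_inv_norm_smul_sub_le {E : Type*} [NormedAddCommGroup E] [NormedSpace ℝ E]
    {m : ℝ} (hm : 0 < m) (x : E) : ‖‖x‖⁻¹ • x - m⁻¹ • x‖ ≤ m⁻¹ * |‖x‖ - m| := by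
  rcases eq_or_ne x 0 with rfl | hx
  · simp; positivity
  · have hx' : 0 < ‖x‖ := norm_pos_iff.2 hx
    rw [← sub_smul, norm_smul, Real.norm_eq_abs]
    have : |‖x‖ - m| = m * ‖x‖ * |‖x‖⁻¹ - m⁻¹| := by
      have h : m - ‖x‖ = m * ‖x‖ * (‖x‖⁻¹ - m⁻¹) := by field_simp
      rw [abs_sub_comm, h, abs_mul, abs_of_pos (mul_pos hm hx')]
    rw [this]
    apply le_of_eq
    field_simp

/-- Concentration of Lipschitz functions on the sphere. -/
theorem lintegral_enorm_sub_sq_unifSphere (hd : 1 ≤ d) {h : EuclideanSpace ℝ (Fin d) → ℝ}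
    {L : ℝ≥0} (hL : LipschitzWith L h) :
    ∫⁻ p, ‖h p.1 - h p.2‖ₑ ^ 2 ∂((unifSphere d).prod (unifSphere d)) ≤
      ENNReal.ofReal (60 * L ^ 2 / d) := by
  have hσ := isProbabilityMeasure_unifSphere hd
  have hdpos : (0 : ℝ) < d := by positivity
  -- For `d ≤ 15` the diameter bound `4 L ^ 2 ≤ 60 L ^ 2 / d` suffices; larger `d` ensures that the
  -- mean norm `m` has `m ^ 2 ≥ d - 5 / 2 ≥ d / 2`.
  rcases le_or_gt d 15 with hd15 | hd15
  · have hb : ∀ᵐ p ∂((unifSphere d).prod (unifSphere d)),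
        ‖h p.1 - h p.2‖ₑ ^ 2 ≤ ENNReal.ofReal (60 * L ^ 2 / d) := by
      filter_upwards [Measure.quasiMeasurePreserving_fst.ae ae_unifSphere_norm,
        Measure.quasiMeasurePreserving_snd.ae ae_unifSphere_norm] with p hp1 hp2
      rw [Real.enorm_sq_eq_ofReal]
      refine ENNReal.ofReal_le_ofReal ?_
      have h1 : |h p.1 - h p.2| ≤ L * 2 := by
        have h2 := hL.dist_le_mul p.1 p.2
        rw [dist_eq_norm, dist_eq_norm, Real.norm_eq_abs] at h2
        refine h2.trans ?_
        gcongr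
        exact (norm_sub_le _ _).trans (by rw [hp1, hp2]; norm_num)
      have h3 : (h p.1 - h p.2) ^ 2 ≤ (L * 2) ^ 2 := by
        rw [← sq_abs]
        gcongr
      refine h3.trans ?_
      rw [le_div_iff₀ hdpos]
      have hd' : (d : ℝ) ≤ 15 := by exact_mod_cast hd15
      nlinarith [sq_nonneg (L : ℝ)]
    exact (lintegral_mono_ae hb).trans (by simp)
  · have hvar := lintegral_sq_norm_sub_mean_stdGaussian_le hd
    have hmsq := sub_sq_integral_norm_stdGaussian_le hd
    have hm0 : 0 ≤ ∫ y, ‖y‖ ∂(stdGaussian (EuclideanSpace ℝ (Fin d))) :=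
      integral_nonneg fun _ => norm_nonneg _
    set m := ∫ y, ‖y‖ ∂(stdGaussian (EuclideanSpace ℝ (Fin d)))
    have hd' : (16 : ℝ) ≤ d := by exact_mod_cast hd15
    have hm2 : (d : ℝ) / 2 ≤ m ^ 2 := by linarith
    have hm : 0 < m := by
      rcases hm0.eq_or_lt with h0 | h0
      · rw [← h0] at hm2; norm_num at hm2; linarith
      · exact h0
    have hk : LipschitzWith (L * ‖m⁻¹‖₊) fun x => h (m⁻¹ • x) := by
      simpa using hL.comp_add_smul 0 m⁻¹
    have hG := lintegral_enorm_sub_sq_stdGaussian hd hk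
    have hT : Measurable fun x : EuclideanSpace ℝ (Fin d) => ‖x‖⁻¹ • x := by fun_prop
    have hhm : Measurable h := hL.continuous.measurable
    have hc : (L : ℝ) * m⁻¹ ≥ 0 := by positivity
    rw [← map_inv_norm_smul_stdGaussian hd, Measure.map_prod_map _ _ hT hT,
      lintegral_map (by fun_prop) (by fun_prop)]
    set γ := stdGaussian (EuclideanSpace ℝ (Fin d))
    have hV : ∀ (q : EuclideanSpace ℝ (Fin d) × EuclideanSpace ℝ (Fin d) →
        EuclideanSpace ℝ (Fin d)), MeasurePreserving q (γ.prod γ) γ →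
        ∫⁻ p, ENNReal.ofReal ((L * m⁻¹) ^ 2) * ENNReal.ofReal ((‖q p‖ - m) ^ 2) ∂(γ.prod γ) ≤
          ENNReal.ofReal ((L * m⁻¹) ^ 2) * ENNReal.ofReal (5 / 2) := by
      intro q hq
      rw [lintegral_const_mul' _ _ ENNReal.ofReal_ne_top]
      gcongr
      refine le_trans (le_of_eq ?_) hvar
      exact hq.lintegral_comp (f := fun x => ENNReal.ofReal ((‖x‖ - m) ^ 2)) (by fun_prop)
    -- Normalizing by the fixed number `m` instead of `‖x‖` keeps the function Lipschitz on the
    -- whole space; the error of this replacement is controlled by the fluctuation of the norm.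
    have hpt : ∀ p : EuclideanSpace ℝ (Fin d) × EuclideanSpace ℝ (Fin d),
        ‖h (‖p.1‖⁻¹ • p.1) - h (‖p.2‖⁻¹ • p.2)‖ₑ ^ 2 ≤
          3 * (‖h (m⁻¹ • p.1) - h (m⁻¹ • p.2)‖ₑ ^ 2 +
            (ENNReal.ofReal ((L * m⁻¹) ^ 2) * ENNReal.ofReal ((‖p.1‖ - m) ^ 2) +
              ENNReal.ofReal ((L * m⁻¹) ^ 2) * ENNReal.ofReal ((‖p.2‖ - m) ^ 2))) := by
      intro p
      have hx : ∀ x : EuclideanSpace ℝ (Fin d),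
          (h (‖x‖⁻¹ • x) - h (m⁻¹ • x)) ^ 2 ≤ (L * m⁻¹) ^ 2 * (‖x‖ - m) ^ 2 := by
        intro x
        rw [← mul_pow, ← sq_abs, ← sq_abs (L * m⁻¹ * (‖x‖ - m)), abs_mul, abs_of_nonneg hc]
        have h2 := hL.dist_le_mul (‖x‖⁻¹ • x) (m⁻¹ • x)
        rw [dist_eq_norm, dist_eq_norm, Real.norm_eq_abs] at h2
        have h3 := norm_inv_norm_smul_sub_le hm x
        gcongr
        refine h2.trans ?_
        rw [mul_assoc]
        gcongr
      rw [Real.enorm_sq_eq_ofReal, Real.enorm_sq_eq_ofReal, ← ENNReal.ofReal_mul (by positivity),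
        ← ENNReal.ofReal_mul (by positivity), ← ENNReal.ofReal_add (by positivity) (by positivity),
        ← ENNReal.ofReal_add (by positivity) (by positivity),
        show (3 : ℝ≥0∞) = ENNReal.ofReal 3 by simp, ← ENNReal.ofReal_mul (by norm_num)]
      refine ENNReal.ofReal_le_ofReal ?_
      have h1 := hx p.1
      have h2 := hx p.2
      set a := h (‖p.1‖⁻¹ • p.1)
      set b := h (‖p.2‖⁻¹ • p.2)
      set a' := h (m⁻¹ • p.1)
      set b' := h (m⁻¹ • p.2)
      have h3 : (a - b) ^ 2 ≤ 3 * ((a' - b') ^ 2 + ((a - a') ^ 2 + (b - b') ^ 2)) := by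
        nlinarith [sq_nonneg ((a - a') - (a' - b')), sq_nonneg ((a - a') + (b - b')),
          sq_nonneg ((a' - b') + (b - b'))]
      linarith
    refine (lintegral_mono hpt).trans ?_
    rw [lintegral_const_mul' _ _ ENNReal.ofNat_ne_top, lintegral_add_left (by fun_prop),
      lintegral_add_left (by fun_prop)]
    refine (mul_le_mul_right (add_le_add hG (add_le_add (hV Prod.fst measurePreserving_fst)
      (hV Prod.snd measurePreserving_snd))) 3).trans ?_
    rw [← ENNReal.ofReal_mul (by positivity), ← ENNReal.ofReal_add (by positivity) (by positivity),
      ← ENNReal.ofReal_add (by positivity) (by positivity), ← ENNReal.ofReal_ofNat,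
      ← ENNReal.ofReal_mul (by norm_num)]
    refine ENNReal.ofReal_le_ofReal ?_
    rw [NNReal.coe_mul, coe_nnnorm, Real.norm_of_nonneg (by positivity : (0 : ℝ) ≤ m⁻¹)]
    have hinv : (m⁻¹) ^ 2 ≤ 2 / d := by
      rw [inv_pow, inv_le_comm₀ (by positivity) (by positivity), inv_div]
      exact hm2
    calc 3 * (5 * (L * m⁻¹) ^ 2 + ((L * m⁻¹) ^ 2 * (5 / 2) + (L * m⁻¹) ^ 2 * (5 / 2)))
        = 30 * (L : ℝ) ^ 2 * (m⁻¹) ^ 2 := by ring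
      _ ≤ 30 * (L : ℝ) ^ 2 * (2 / d) := by gcongr
      _ = 60 * L ^ 2 / d := by ring

end SphereVariance

/-! ### Disintegration by conditional laws and by independence. -/

section ConditionalLaw

variable {Ω S 𝒳 𝒵 : Type*} {m : MeasurableSpace Ω} [mΩ : MeasurableSpace Ω] [MeasurableSpace S] [MeasurableSpace 𝒳]
  [MeasurableSpace 𝒵] {μ : Measure Ω} [IsProbabilityMeasure μ]

/-- If the conditional law of `ξ` given `m` is `κ (p Z)` with `Z` measurable with respect to `m`,
then the joint law of `(Z, ξ)` disintegrates accordingly. -/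
theorem map_prodMk_eq_compProd (hm : m ≤ mΩ) {ξ : Ω → S}
    (hξ : Measurable ξ) (κ : Kernel 𝒳 S) [IsMarkovKernel κ] {Z : Ω → 𝒵}
    (hZ : Measurable[m] Z) {p : 𝒵 → 𝒳} (hp : Measurable p)
    (h : ∀ B : Set S, MeasurableSet B →
      μ[(ξ ⁻¹' B).indicator (fun _ => (1 : ℝ)) | m] =ᵐ[μ] fun ω => (κ (p (Z ω))).real B) :
    μ.map (fun ω => (Z ω, ξ ω)) = (μ.map Z) ⊗ₘ (κ.comap p hp) := by
  have hZ' : Measurable Z := hZ.mono hm le_rfl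
  have : IsProbabilityMeasure (μ.map Z) := Measure.isProbabilityMeasure_map hZ'.aemeasurable
  have : IsProbabilityMeasure (μ.map (fun ω => (Z ω, ξ ω))) :=
    Measure.isProbabilityMeasure_map (hZ'.prodMk hξ).aemeasurable
  refine Measure.ext_prod fun {A B} hA hB => ?_
  have hZA : MeasurableSet[m] (Z ⁻¹' A) := hZ hA
  have hB' : MeasurableSet (ξ ⁻¹' B) := hξ hB
  have hκB : Measurable fun ω => κ (p (Z ω)) B := (κ.measurable_coe hB).comp (hp.comp hZ')
  rw [Measure.map_apply (hZ'.prodMk hξ) (hA.prod hB), Measure.compProd_apply_prod hA hB]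
  simp only [Kernel.comap_apply]
  rw [setLIntegral_map (f := fun z => κ (p z) B) hA ((κ.measurable_coe hB).comp hp) hZ']
  -- This is the defining property of conditional expectation on the `m`-measurable event `Z ⁻¹' A`;
  -- rectangles determine the joint law.
  have h1 : ∫ ω in Z ⁻¹' A, (κ (p (Z ω))).real B ∂μ = μ.real (ξ ⁻¹' B ∩ Z ⁻¹' A) := by
    rw [← setIntegral_congr_ae (hm _ hZA) ((h B hB).mono fun ω hω _ => hω),
      setIntegral_condExp hm ((integrable_const (1 : ℝ)).indicator hB') hZA,
      integral_indicator hB', Measure.restrict_restrict hB']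
    simp
  have h2 : ∫⁻ ω in Z ⁻¹' A, κ (p (Z ω)) B ∂μ =
      ENNReal.ofReal (∫ ω in Z ⁻¹' A, (κ (p (Z ω))).real B ∂μ) := by
    rw [ofReal_integral_eq_lintegral_ofReal _ (.of_forall fun _ => measureReal_nonneg)]
    · simp
    · refine Integrable.of_bound hκB.ennreal_toReal.aestronglyMeasurable 1
        (.of_forall fun ω => ?_)
      rw [Real.norm_of_nonneg measureReal_nonneg]
      exact measureReal_le_one
  rw [h2, h1, measureReal_def, ENNReal.ofReal_toReal (measure_ne_top _ _), Set.inter_comm]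
  rfl

variable {U : Type*} [MeasurableSpace U]

theorem map_prodMk_eq_prod_of_indep (hm : m ≤ mΩ) {u : Ω → U}
    (hu : Measurable u) (hind : Indep (MeasurableSpace.comap u inferInstance) m μ)
    {Z : Ω → 𝒵} (hZ : Measurable[m] Z) :
    μ.map (fun ω => (Z ω, u ω)) = (μ.map Z).prod (μ.map u) := by
  refine (indepFun_iff_map_prod_eq_prod_map_map (hZ.mono hm le_rfl).aemeasurable
    hu.aemeasurable).1 ?_
  rw [IndepFun_iff_Indep]
  exact (indep_of_indep_of_le_right hind hZ.comap_le).symm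

theorem lintegral_comp_of_indep (hm : m ≤ mΩ) {u : Ω → U}
    (hu : Measurable u) (hind : Indep (MeasurableSpace.comap u inferInstance) m μ)
    {Z : Ω → 𝒵} (hZ : Measurable[m] Z) {K : 𝒵 × U → ℝ≥0∞} (hK : Measurable K) :
    ∫⁻ ω, K (Z ω, u ω) ∂μ = ∫⁻ ω, ∫⁻ v, K (Z ω, v) ∂(μ.map u) ∂μ := by
  have hZ' : Measurable Z := hZ.mono hm le_rfl
  have : IsProbabilityMeasure (μ.map u) := Measure.isProbabilityMeasure_map hu.aemeasurable
  rw [← lintegral_map hK (hZ'.prodMk hu), map_prodMk_eq_prod_of_indep hm hu hind hZ,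
    lintegral_prod _ hK.aemeasurable, lintegral_map hK.lintegral_prod_right' hZ']

theorem integral_comp_of_indep {F : Type*} [NormedAddCommGroup F] [NormedSpace ℝ F]
    [MeasurableSpace F] [BorelSpace F] [SecondCountableTopology F]
    (hm : m ≤ mΩ) {u : Ω → U}
    (hu : Measurable u) (hind : Indep (MeasurableSpace.comap u inferInstance) m μ)
    {Z : Ω → 𝒵} (hZ : Measurable[m] Z) {K : 𝒵 × U → F} (hK : Measurable K)
    (hint : Integrable (fun ω => K (Z ω, u ω)) μ) :
    ∫ ω, K (Z ω, u ω) ∂μ = ∫ ω, ∫ v, K (Z ω, v) ∂(μ.map u) ∂μ := by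
  have hZ' : Measurable Z := hZ.mono hm le_rfl
  have : IsProbabilityMeasure (μ.map u) := Measure.isProbabilityMeasure_map hu.aemeasurable
  have hZu : AEMeasurable (fun ω => (Z ω, u ω)) μ := (hZ'.prodMk hu).aemeasurable
  have hint' : Integrable K (μ.map fun ω => (Z ω, u ω)) :=
    (integrable_map_measure hK.aestronglyMeasurable hZu).2 hint
  rw [← integral_map hZu hK.aestronglyMeasurable]
  rw [map_prodMk_eq_prod_of_indep hm hu hind hZ] at hint' ⊢
  rw [integral_prod _ hint', integral_map hZ'.aemeasurable]
  exact hK.stronglyMeasurable.integral_prod_right'.aestronglyMeasurable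

end ConditionalLaw

/-! ### Oracle noise along the sampling protocol. -/

section Protocol

variable {d : ℕ} {S Ω : Type*} [MeasurableSpace S] [mΩ : MeasurableSpace Ω] {μ : Measure Ω}
  [IsProbabilityMeasure μ] {Ξ : Kernel (EuclideanSpace ℝ (Fin d)) S} [IsMarkovKernel Ξ]
  {F : EuclideanSpace ℝ (Fin d) → S → ℝ} {f : EuclideanSpace ℝ (Fin d) → ℝ} {σ δ : ℝ}
  {𝒢 : Filtration ℕ mΩ} {y u : ℕ → Ω → EuclideanSpace ℝ (Fin d)} {ξ : ℕ → Ω → S}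

namespace IsOnePointSampling

omit [IsProbabilityMeasure μ] [IsMarkovKernel Ξ] in
theorem ae_norm_direction (hs : IsOnePointSampling μ Ξ δ 𝒢 y u ξ) (t : ℕ) :
    ∀ᵐ ω ∂μ, ‖u t ω‖ = 1 := by
  have h := ae_unifSphere_norm (d := d)
  rw [← hs.law_direction t] at h
  exact ae_of_ae_map ((hs.measurable_direction t).mono (𝒢.le _) le_rfl).aemeasurable h

omit [IsProbabilityMeasure μ] [IsMarkovKernel Ξ] in
theorem sup_comap_le (hs : IsOnePointSampling μ Ξ δ 𝒢 y u ξ) (t : ℕ) :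
    𝒢 t ⊔ MeasurableSpace.comap (u t) inferInstance ≤ mΩ :=
  sup_le (𝒢.le t) ((hs.measurable_direction t).mono (𝒢.le _) le_rfl).comap_le

omit [IsProbabilityMeasure μ] [IsMarkovKernel Ξ] in
theorem measurable_query (hs : IsOnePointSampling μ Ξ δ 𝒢 y u ξ) (t : ℕ) :
    Measurable[𝒢 t ⊔ MeasurableSpace.comap (u t) inferInstance]
      fun ω => y t ω + δ • u t ω := by
  have h1 : Measurable[𝒢 t ⊔ MeasurableSpace.comap (u t) inferInstance] (y t) :=
    (hs.measurable_point t).mono le_sup_left le_rfl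
  have h2 : Measurable[𝒢 t ⊔ MeasurableSpace.comap (u t) inferInstance] (u t) :=
    (comap_measurable (u t)).mono le_sup_right le_rfl
  exact h1.add (h2.const_smul δ)

/-- The second moment of the oracle noise along the protocol. -/
theorem lintegral_noise_sq_le (hs : IsOnePointSampling μ Ξ δ 𝒢 y u ξ)
    (hO : IsStochasticOracle Ξ F f σ) (hF : Measurable (Function.uncurry F)) (hf : Measurable f)
    (t : ℕ) :
    ∫⁻ ω, ‖F (y t ω + δ • u t ω) (ξ t ω) - f (y t ω + δ • u t ω)‖ₑ ^ 2 ∂μ ≤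
      ENNReal.ofReal (σ ^ 2) := by
  have hξ := (hs.measurable_sample t).mono (𝒢.le _) le_rfl
  have hx := hs.measurable_query t
  have hx' := hx.mono (hs.sup_comap_le t) le_rfl
  have hlaw := map_prodMk_eq_compProd (hs.sup_comap_le t) hξ Ξ hx measurable_id
    (hs.condLaw_sample t)
  have hK : Measurable fun q : EuclideanSpace ℝ (Fin d) × S => ‖F q.1 q.2 - f q.1‖ₑ ^ 2 :=
    (hF.sub (hf.comp measurable_fst)).enorm.pow_const 2
  have : IsProbabilityMeasure (μ.map fun ω => y t ω + δ • u t ω) :=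
    Measure.isProbabilityMeasure_map hx'.aemeasurable
  rw [← lintegral_map (f := fun q : EuclideanSpace ℝ (Fin d) × S => ‖F q.1 q.2 - f q.1‖ₑ ^ 2)
    hK (hx'.prodMk hξ), hlaw, Measure.lintegral_compProd hK]
  refine (lintegral_mono fun x => hO.variance_le x).trans ?_
  simp

omit [IsProbabilityMeasure μ] [IsMarkovKernel Ξ] in
theorem measurable_noise (hs : IsOnePointSampling μ Ξ δ 𝒢 y u ξ)
    (hF : Measurable (Function.uncurry F)) (hf : Measurable f) (t : ℕ) :
    Measurable fun ω => F (y t ω + δ • u t ω) (ξ t ω) - f (y t ω + δ • u t ω) := by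
  have hξ := (hs.measurable_sample t).mono (𝒢.le _) le_rfl
  have hx' := (hs.measurable_query t).mono (hs.sup_comap_le t) le_rfl
  exact (hF.comp (hx'.prodMk hξ)).sub (hf.comp hx')

theorem integrable_noise (hs : IsOnePointSampling μ Ξ δ 𝒢 y u ξ)
    (hO : IsStochasticOracle Ξ F f σ) (hF : Measurable (Function.uncurry F)) (hf : Measurable f)
    (t : ℕ) :
    Integrable (fun ω => F (y t ω + δ • u t ω) (ξ t ω) - f (y t ω + δ • u t ω)) μ := by
  refine MemLp.integrable (q := 2) (by norm_num)
    ⟨(hs.measurable_noise hF hf t).aestronglyMeasurable, ?_⟩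
  rw [eLpNorm_lt_top_iff_lintegral_rpow_enorm_lt_top two_ne_zero ENNReal.ofNat_ne_top]
  simpa using (hs.lintegral_noise_sq_le hO hF hf t).trans_lt ENNReal.ofReal_lt_top

omit [IsProbabilityMeasure μ] [IsMarkovKernel Ξ] in
theorem measurable_direction' (hs : IsOnePointSampling μ Ξ δ 𝒢 y u ξ) (t : ℕ) :
    Measurable (u t) :=
  (hs.measurable_direction t).mono (𝒢.le _) le_rfl

omit [IsProbabilityMeasure μ] [IsMarkovKernel Ξ] in
theorem integrable_smul_direction (hs : IsOnePointSampling μ Ξ δ 𝒢 y u ξ) (t : ℕ)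
    {c : Ω → ℝ} (hc : Integrable c μ) : Integrable (fun ω => c ω • u t ω) μ := by
  refine hc.mono (hc.1.smul (hs.measurable_direction' t).aestronglyMeasurable) ?_
  filter_upwards [hs.ae_norm_direction t] with ω hω
  rw [norm_smul, hω, mul_one]

/-- The oracle noise is conditionally centered given the past and the direction. -/
theorem setIntegral_noise_smul_direction (hs : IsOnePointSampling μ Ξ δ 𝒢 y u ξ)
    (hO : IsStochasticOracle Ξ F f σ) (hF : Measurable (Function.uncurry F)) (hf : Measurable f)
    (t : ℕ) {A : Set Ω} (hA : MeasurableSet[𝒢 t] A) :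
    ∫ ω in A, (F (y t ω + δ • u t ω) (ξ t ω) - f (y t ω + δ • u t ω)) • u t ω ∂μ = 0 := by
  have hξ := (hs.measurable_sample t).mono (𝒢.le _) le_rfl
  have hx := hs.measurable_query t
  have hu : Measurable[𝒢 t ⊔ MeasurableSpace.comap (u t) inferInstance] (u t) :=
    (comap_measurable (u t)).mono le_sup_right le_rfl
  have hA1 : MeasurableSet[𝒢 t ⊔ MeasurableSpace.comap (u t) inferInstance] A :=
    (le_sup_left : 𝒢 t ≤ _) A hA
  -- The event `A` is absorbed into the conditioning variable by cutting `u t` off outside it, so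
  -- the set integral becomes a full integral of one function of the pair `(Z, ξ)`.
  have hZ : Measurable[𝒢 t ⊔ MeasurableSpace.comap (u t) inferInstance]
      fun ω => (A.indicator (u t) ω, y t ω + δ • u t ω) := (hu.indicator hA1).prodMk hx
  have hZ' := hZ.mono (hs.sup_comap_le t) le_rfl
  have hlaw := map_prodMk_eq_compProd (hs.sup_comap_le t) hξ Ξ hZ measurable_snd
    (hs.condLaw_sample t)
  let K : (EuclideanSpace ℝ (Fin d) × EuclideanSpace ℝ (Fin d)) × S → EuclideanSpace ℝ (Fin d) :=
    fun q => (F q.1.2 q.2 - f q.1.2) • q.1.1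
  have hK : Measurable K := by
    have h1 : Measurable fun q : (EuclideanSpace ℝ (Fin d) × EuclideanSpace ℝ (Fin d)) × S =>
        F q.1.2 q.2 := hF.comp ((measurable_snd.comp measurable_fst).prodMk measurable_snd)
    have h2 : Measurable fun q : (EuclideanSpace ℝ (Fin d) × EuclideanSpace ℝ (Fin d)) × S =>
        f q.1.2 := hf.comp (measurable_snd.comp measurable_fst)
    exact (h1.sub h2).smul (measurable_fst.comp measurable_fst)
  have hpt : ∀ ω, A.indicator (fun ω => (F (y t ω + δ • u t ω) (ξ t ω) -
      f (y t ω + δ • u t ω)) • u t ω) ω =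
      K ((A.indicator (u t) ω, y t ω + δ • u t ω), ξ t ω) := by
    intro ω
    by_cases h : ω ∈ A <;> simp [K, h]
  have hA' : MeasurableSet A := 𝒢.le t A hA
  have hint : Integrable (fun ω => K ((A.indicator (u t) ω, y t ω + δ • u t ω), ξ t ω)) μ := by
    simp_rw [← hpt]
    exact (hs.integrable_smul_direction t (hs.integrable_noise hO hF hf t)).indicator hA'
  have hZξ := (hZ'.prodMk hξ).aemeasurable (μ := μ)
  have hint' := (integrable_map_measure hK.aestronglyMeasurable hZξ).2 hint
  have : IsProbabilityMeasure (μ.map fun ω => (A.indicator (u t) ω, y t ω + δ • u t ω)) :=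
    Measure.isProbabilityMeasure_map hZ'.aemeasurable
  rw [← integral_indicator hA']
  simp_rw [hpt]
  rw [← integral_map hZξ hK.aestronglyMeasurable]
  rw [hlaw] at hint' ⊢
  rw [Measure.integral_compProd hint']
  refine integral_eq_zero_of_ae (.of_forall fun z => ?_)
  simp only [K, Kernel.comap_apply, Pi.zero_apply]
  rw [integral_smul_const, integral_sub (hO.integrable _) (integrable_const _), hO.mean_eq]
  simp

end IsOnePointSampling

end Protocol

/-! ### Integrability, bias and second moment of the residual estimator. -/

section Estimator

variable {d : ℕ} {S Ω : Type*} [MeasurableSpace S] [mΩ : MeasurableSpace Ω] {μ : Measure Ω}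
  [IsProbabilityMeasure μ] {Ξ : Kernel (EuclideanSpace ℝ (Fin d)) S} [IsMarkovKernel Ξ]
  {F : EuclideanSpace ℝ (Fin d) → S → ℝ} {f : EuclideanSpace ℝ (Fin d) → ℝ} {σ δ : ℝ}
  {𝒢 : Filtration ℕ mΩ} {y u : ℕ → Ω → EuclideanSpace ℝ (Fin d)} {ξ : ℕ → Ω → S} {L : ℝ≥0}

namespace IsOnePointSampling

theorem integrable_onePointResidual (hs : IsOnePointSampling μ Ξ δ 𝒢 y u ξ)
    (hO : IsStochasticOracle Ξ F f σ) (hF : Measurable (Function.uncurry F))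
    (hL : LipschitzWith L f) (t : ℕ)
    (hy : Integrable (fun ω => y (t + 1) ω - y t ω) μ) :
    Integrable (fun ω => onePointResidual F δ (y (t + 1) ω) (u (t + 1) ω) (ξ (t + 1) ω)
      (y t ω) (u t ω) (ξ t ω)) μ := by
  have hf := hL.continuous.measurable
  have hx : ∀ t, Measurable fun ω => y t ω + δ • u t ω := fun t =>
    (hs.measurable_query t).mono (hs.sup_comap_le t) le_rfl
  have hfd : Integrable (fun ω => f (y (t + 1) ω + δ • u (t + 1) ω) - f (y t ω + δ • u t ω)) μ := by
    refine Integrable.mono' (g := fun ω => L * (‖y (t + 1) ω - y t ω‖ + |δ| * 2))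
      ((hy.norm.add (integrable_const _)).const_mul _)
      ((hf.comp (hx (t + 1))).sub (hf.comp (hx t))).aestronglyMeasurable ?_
    filter_upwards [hs.ae_norm_direction t, hs.ae_norm_direction (t + 1)] with ω h1 h2
    have h3 := hL.dist_le_mul (y (t + 1) ω + δ • u (t + 1) ω) (y t ω + δ • u t ω)
    rw [dist_eq_norm, dist_eq_norm] at h3
    refine h3.trans ?_
    gcongr
    rw [show y (t + 1) ω + δ • u (t + 1) ω - (y t ω + δ • u t ω) =
      (y (t + 1) ω - y t ω) + δ • (u (t + 1) ω - u t ω) by rw [smul_sub]; abel]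
    refine (norm_add_le _ _).trans ?_
    rw [norm_smul, Real.norm_eq_abs]
    gcongr
    exact (norm_sub_le _ _).trans (by rw [h1, h2]; norm_num)
  have hi := hs.integrable_smul_direction (t + 1)
    ((((hs.integrable_noise hO hF hf (t + 1)).sub (hs.integrable_noise hO hF hf t)).add
      hfd).const_mul (d / δ))
  refine hi.congr (.of_forall fun ω => ?_)
  simp only [onePointResidual, Pi.add_apply, Pi.sub_apply]
  congr 2
  ring

/-- Conditionally on the past, the residual estimator is unbiased for the gradient of the
smoothed surrogate. -/
theorem condExp_onePointResidual (hd : 1 ≤ d) (hδ : 0 < δ)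
    (hs : IsOnePointSampling μ Ξ δ 𝒢 y u ξ)
    (hO : IsStochasticOracle Ξ F f σ) (hF : Measurable (Function.uncurry F))
    (hL : LipschitzWith L f) (t : ℕ)
    (hg : Integrable (fun ω => onePointResidual F δ (y (t + 1) ω) (u (t + 1) ω) (ξ (t + 1) ω)
      (y t ω) (u t ω) (ξ t ω)) μ) :
    μ[fun ω => onePointResidual F δ (y (t + 1) ω) (u (t + 1) ω) (ξ (t + 1) ω)
      (y t ω) (u t ω) (ξ t ω) | 𝒢 (t + 1)] =ᵐ[μ]
      fun ω => gradient (smoothedSurrogate f δ) (y (t + 1) ω) := by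
  have hσ := isProbabilityMeasure_unifSphere hd
  have hf := hL.continuous.measurable
  have hd0 : (d : ℝ) / δ ≠ 0 := by positivity
  have hgrad := continuous_gradient_smoothedSurrogate hd hL hδ
  have hy := hs.measurable_point (t + 1)
  have hu := hs.measurable_direction' (t + 1)
  have hgm : Measurable[𝒢 (t + 1)] fun ω => gradient (smoothedSurrogate f δ) (y (t + 1) ω) :=
    hgrad.measurable.comp hy
  have hbound : ∀ x, ‖gradient (smoothedSurrogate f δ) x‖ ≤ L := fun x => by
    rw [gradient, LinearIsometryEquiv.norm_map]
    exact norm_fderiv_le_of_lipschitz ℝ (lipschitzWith_smoothedSurrogate hL δ)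
  have hgi : Integrable (fun ω => gradient (smoothedSurrogate f δ) (y (t + 1) ω)) μ :=
    Integrable.of_bound (hgm.mono (𝒢.le _) le_rfl).aestronglyMeasurable L
      (.of_forall fun ω => hbound _)
  refine (ae_eq_condExp_of_forall_setIntegral_eq (𝒢.le _) hg (fun _ _ _ => hgi.integrableOn)
    (fun A hA _ => ?_) hgm.aestronglyMeasurable).symm
  have hA' : MeasurableSet A := 𝒢.le _ A hA
  have hprev : Measurable[𝒢 (t + 1)] fun ω => F (y t ω + δ • u t ω) (ξ t ω) := by
    have h1 : Measurable[𝒢 (t + 1)] fun ω => y t ω + δ • u t ω :=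
      ((hs.measurable_point t).mono (𝒢.mono t.le_succ) le_rfl).add
        ((hs.measurable_direction t).const_smul δ)
    exact hF.comp (h1.prodMk (hs.measurable_sample t))
  -- This is the noise-free part of the residual without the factor `d / δ`. Its first argument
  -- collects what is known before the new direction: the indicator of `A`, the new point and the
  -- previous oracle value.
  let K : (ℝ × EuclideanSpace ℝ (Fin d) × ℝ) × EuclideanSpace ℝ (Fin d) →
      EuclideanSpace ℝ (Fin d) := fun q => (q.1.1 * (f (q.1.2.1 + δ • q.2) - q.1.2.2)) • q.2
  have hK : Measurable K := by fun_prop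
  let Z : Ω → ℝ × EuclideanSpace ℝ (Fin d) × ℝ := fun ω =>
    (A.indicator 1 ω, y (t + 1) ω, F (y t ω + δ • u t ω) (ξ t ω))
  have hAm : Measurable[𝒢 (t + 1)] (A.indicator (1 : Ω → ℝ)) :=
    Measurable.indicator (@measurable_const _ _ _ (𝒢 (t + 1)) (1 : ℝ)) hA
  have hZ : Measurable[𝒢 (t + 1)] Z := hAm.prodMk (hy.prodMk hprev)
  have hN := hs.integrable_smul_direction (t + 1) (hs.integrable_noise hO hF hf (t + 1))
  have hres : ∀ ω, A.indicator (fun ω => onePointResidual F δ (y (t + 1) ω) (u (t + 1) ω)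
      (ξ (t + 1) ω) (y t ω) (u t ω) (ξ t ω)) ω =
      ((d : ℝ) / δ) • (A.indicator (fun ω => (F (y (t + 1) ω + δ • u (t + 1) ω) (ξ (t + 1) ω) -
        f (y (t + 1) ω + δ • u (t + 1) ω)) • u (t + 1) ω) ω + K (Z ω, u (t + 1) ω)) := by
    intro ω
    by_cases h : ω ∈ A
    · simp only [Set.indicator_of_mem h, onePointResidual, K, Z, Pi.one_apply, one_mul]
      rw [← add_smul, smul_smul]
      congr 2
      ring
    · simp [Set.indicator_of_notMem h, K, Z]
  -- Integrability comes by subtraction from the assumed integrability of the residual, since the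
  -- oracle values alone need not be integrable.
  have hKi : Integrable (fun ω => K (Z ω, u (t + 1) ω)) μ := by
    refine (((hg.indicator hA').smul ((d : ℝ) / δ)⁻¹).sub (hN.indicator hA')).congr
      (.of_forall fun ω => ?_)
    simp only [Pi.sub_apply, Pi.smul_apply]
    rw [hres, smul_smul, inv_mul_cancel₀ hd0, one_smul, add_sub_cancel_left]
  have hN0 := hs.setIntegral_noise_smul_direction hO hF hf (t + 1) hA
  rw [← integral_indicator hA'] at hN0
  rw [← integral_indicator hA', ← integral_indicator hA']
  simp_rw [hres]
  rw [integral_smul, integral_add (hN.indicator hA') hKi, hN0, zero_add,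
    integral_comp_of_indep (𝒢.le (t + 1)) hu (hs.indep_direction (t + 1)) hZ hK hKi,
    hs.law_direction, ← integral_smul]
  refine integral_congr_ae (.of_forall fun ω => ?_)
  have hKint : ∀ (a c : ℝ) (x : EuclideanSpace ℝ (Fin d)),
      ∫ v, K ((a, x, c), v) ∂(unifSphere d) = a • ∫ v, f (x + δ • v) • v ∂(unifSphere d) := by
    intro a c x
    have hi : Integrable (fun v : EuclideanSpace ℝ (Fin d) => v) (unifSphere d) := by
      refine Integrable.of_bound measurable_id.aestronglyMeasurable 1 ?_
      filter_upwards [ae_unifSphere_norm] with v hv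
      exact hv.le
    have hci : Integrable (fun v : EuclideanSpace ℝ (Fin d) => c • v) (unifSphere d) := hi.smul c
    simp only [K, mul_smul, sub_smul]
    rw [integral_smul, integral_sub (hL.integrable_unifSphere hd x δ) hci,
      integral_smul, integral_id_unifSphere hd, smul_zero, sub_zero]
  dsimp only [Z]
  rw [hKint]
  by_cases h : ω ∈ A
  · simp [Set.indicator_of_mem h, gradient_smoothedSurrogate hd hL hδ]
  · simp [Set.indicator_of_notMem h]

omit [IsMarkovKernel Ξ] in
/-- Two consecutive directions, queried around the same point, give close function values. -/
theorem lintegral_directions_sub_sq_le (hd : 1 ≤ d) (hδ : 0 < δ)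
    (hs : IsOnePointSampling μ Ξ δ 𝒢 y u ξ) (hL : LipschitzWith L f) (t : ℕ) :
    ∫⁻ ω, ‖f (y t ω + δ • u (t + 1) ω) - f (y t ω + δ • u t ω)‖ₑ ^ 2 ∂μ ≤
      ENNReal.ofReal (60 * (L * δ) ^ 2 / d) := by
  have hσ := isProbabilityMeasure_unifSphere hd
  have hf := hL.continuous.measurable
  let K : (EuclideanSpace ℝ (Fin d) × EuclideanSpace ℝ (Fin d)) × EuclideanSpace ℝ (Fin d) →
      ℝ≥0∞ := fun q => ‖f (q.1.1 + δ • q.2) - f (q.1.1 + δ • q.1.2)‖ₑ ^ 2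
  have hK : Measurable K := by fun_prop
  have hZ : Measurable[𝒢 (t + 1)] fun ω => (y t ω, u t ω) :=
    ((hs.measurable_point t).mono (𝒢.mono t.le_succ) le_rfl).prodMk (hs.measurable_direction t)
  -- The directions are integrated out from the latest backwards, which leaves, for each value of `y
  -- t`, a double integral over two independent uniform directions.
  have h1 := lintegral_comp_of_indep (𝒢.le (t + 1)) (hs.measurable_direction' (t + 1))
    (hs.indep_direction (t + 1)) hZ hK
  have hK' : Measurable fun q : EuclideanSpace ℝ (Fin d) × EuclideanSpace ℝ (Fin d) =>
      ∫⁻ v, K (q, v) ∂(unifSphere d) := hK.lintegral_prod_right'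
  have h2 := lintegral_comp_of_indep (𝒢.le t) (hs.measurable_direction' t)
    (hs.indep_direction t) (hs.measurable_point t) hK'
  rw [hs.law_direction] at h1 h2
  change ∫⁻ ω, K ((y t ω, u t ω), u (t + 1) ω) ∂μ ≤ _
  rw [h1, h2]
  refine (lintegral_mono (g := fun _ => ENNReal.ofReal (60 * (L * δ) ^ 2 / d)) fun ω => ?_).trans
    (by simp)
  have h3 := lintegral_enorm_sub_sq_unifSphere hd (hL.comp_add_smul (y t ω) δ)
  rw [lintegral_prod_symm' _ (by fun_prop)] at h3
  simpa [abs_of_pos hδ] using h3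

/-- The two noises and the sum `D + B` share a factor `3`, and splitting `D + B` costs a further
`2`; hence `3 + 3` in front of `σ ^ 2` and `6` in front of the rest. No moment of the step is
assumed: the pointwise bound is integrated in `[0, ∞]`. -/
theorem lintegral_onePointResidual_sq_le (hd : 1 ≤ d) (hδ : 0 < δ)
    (hs : IsOnePointSampling μ Ξ δ 𝒢 y u ξ)
    (hO : IsStochasticOracle Ξ F f σ) (hF : Measurable (Function.uncurry F))
    (hL : LipschitzWith L f) (t : ℕ) :
    ∫⁻ ω, ‖onePointResidual F δ (y (t + 1) ω) (u (t + 1) ω) (ξ (t + 1) ω)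
      (y t ω) (u t ω) (ξ t ω)‖ₑ ^ 2 ∂μ ≤
      ENNReal.ofReal (6 * (d : ℝ) ^ 2 * σ ^ 2 / δ ^ 2
        + 144 * √(2 * Real.pi) * (d : ℝ) * (L : ℝ) ^ 2)
      + ENNReal.ofReal (6 * (d : ℝ) ^ 2 * (L : ℝ) ^ 2 / δ ^ 2)
        * ∫⁻ ω, ‖y (t + 1) ω - y t ω‖ₑ ^ 2 ∂μ := by
  have hf := hL.continuous.measurable
  set N : ℕ → Ω → ℝ := fun t ω =>
    F (y t ω + δ • u t ω) (ξ t ω) - f (y t ω + δ • u t ω) with hNdef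
  set D : Ω → ℝ := fun ω => f (y t ω + δ • u (t + 1) ω) - f (y t ω + δ • u t ω) with hDdef
  have hNm : ∀ s, Measurable (N s) := fun s => hs.measurable_noise hF hf s
  have hym : ∀ s, Measurable (y s) := fun s => (hs.measurable_point s).mono (𝒢.le _) le_rfl
  have hum := hs.measurable_direction'
  have hDm : Measurable D := by
    have := hym t; have := hum t; have := hum (t + 1); fun_prop
  have hyd : Measurable fun ω => y (t + 1) ω - y t ω := (hym _).sub (hym _)
  have hpt : ∀ᵐ ω ∂μ, ‖onePointResidual F δ (y (t + 1) ω) (u (t + 1) ω) (ξ (t + 1) ω)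
      (y t ω) (u t ω) (ξ t ω)‖ₑ ^ 2 ≤
      ENNReal.ofReal (3 * d ^ 2 / δ ^ 2) * ‖N (t + 1) ω‖ₑ ^ 2 +
      (ENNReal.ofReal (3 * d ^ 2 / δ ^ 2) * ‖N t ω‖ₑ ^ 2 +
      (ENNReal.ofReal (6 * d ^ 2 / δ ^ 2) * ‖D ω‖ₑ ^ 2 +
      ENNReal.ofReal (6 * (d : ℝ) ^ 2 * (L : ℝ) ^ 2 / δ ^ 2) *
        ‖y (t + 1) ω - y t ω‖ₑ ^ 2)) := by
    filter_upwards [hs.ae_norm_direction (t + 1)] with ω hω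
    rw [enorm_sq_eq_ofReal_norm, Real.enorm_sq_eq_ofReal, Real.enorm_sq_eq_ofReal,
      Real.enorm_sq_eq_ofReal, enorm_sq_eq_ofReal_norm,
      ← ENNReal.ofReal_mul (by positivity), ← ENNReal.ofReal_mul (by positivity),
      ← ENNReal.ofReal_mul (by positivity), ← ENNReal.ofReal_mul (by positivity),
      ← ENNReal.ofReal_add (by positivity) (by positivity),
      ← ENNReal.ofReal_add (by positivity) (by positivity),
      ← ENNReal.ofReal_add (by positivity) (by positivity)]
    refine ENNReal.ofReal_le_ofReal ?_
    set B := f (y (t + 1) ω + δ • u (t + 1) ω) - f (y t ω + δ • u (t + 1) ω) with hB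
    have hBle : B ^ 2 ≤ L ^ 2 * ‖y (t + 1) ω - y t ω‖ ^ 2 := by
      have h3 := hL.dist_le_mul (y (t + 1) ω + δ • u (t + 1) ω) (y t ω + δ • u (t + 1) ω)
      rw [dist_eq_norm, dist_eq_norm, add_sub_add_right_eq_sub, Real.norm_eq_abs] at h3
      rw [← mul_pow, ← sq_abs]
      gcongr
    have hg : F (y (t + 1) ω + δ • u (t + 1) ω) (ξ (t + 1) ω) - F (y t ω + δ • u t ω) (ξ t ω) =
        N (t + 1) ω - N t ω + (D ω + B) := by
      simp only [hNdef, hDdef, hB]; ring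
    rw [onePointResidual, norm_smul, hω, mul_one, Real.norm_eq_abs, sq_abs, hg, mul_pow, div_pow]
    set c : ℝ := (d : ℝ) ^ 2 / δ ^ 2 with hc
    have hc0 : 0 ≤ c := by positivity
    have hsq : (N (t + 1) ω - N t ω + (D ω + B)) ^ 2 ≤
        3 * N (t + 1) ω ^ 2 + (3 * N t ω ^ 2 + (6 * D ω ^ 2 + 6 * B ^ 2)) := by
      nlinarith [sq_nonneg (N (t + 1) ω + N t ω), sq_nonneg (N (t + 1) ω - (D ω + B)),
        sq_nonneg (N t ω + (D ω + B)), sq_nonneg (D ω - B)]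
    calc c * (N (t + 1) ω - N t ω + (D ω + B)) ^ 2
        ≤ c * (3 * N (t + 1) ω ^ 2 + (3 * N t ω ^ 2 + (6 * D ω ^ 2 +
            6 * (L ^ 2 * ‖y (t + 1) ω - y t ω‖ ^ 2)))) := by
          gcongr
          linarith
      _ = _ := by rw [hc]; ring
  refine (lintegral_mono_ae hpt).trans ?_
  rw [lintegral_add_left (by fun_prop), lintegral_add_left (by fun_prop),
    lintegral_add_left (by fun_prop), lintegral_const_mul' _ _ ENNReal.ofReal_ne_top,
    lintegral_const_mul' _ _ ENNReal.ofReal_ne_top, lintegral_const_mul' _ _ ENNReal.ofReal_ne_top,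
    lintegral_const_mul' _ _ ENNReal.ofReal_ne_top, ← add_assoc, ← add_assoc]
  gcongr ?_ + _
  have h1 := hs.lintegral_noise_sq_le hO hF hf (t + 1)
  have h2 := hs.lintegral_noise_sq_le hO hF hf t
  have h3 := hs.lintegral_directions_sub_sq_le hd hδ hL t
  calc _ ≤ ENNReal.ofReal (3 * d ^ 2 / δ ^ 2) * ENNReal.ofReal (σ ^ 2) +
        ENNReal.ofReal (3 * d ^ 2 / δ ^ 2) * ENNReal.ofReal (σ ^ 2) +
        ENNReal.ofReal (6 * d ^ 2 / δ ^ 2) * ENNReal.ofReal (60 * (L * δ) ^ 2 / d) := by gcongr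
    _ ≤ _ := by
      rw [← ENNReal.ofReal_mul (by positivity), ← ENNReal.ofReal_mul (by positivity),
        ← ENNReal.ofReal_add (by positivity) (by positivity),
        ← ENNReal.ofReal_add (by positivity) (by positivity)]
      refine ENNReal.ofReal_le_ofReal ?_
      -- The proof yields `6 * 60 = 360 = 144 * (5 / 2)` in front of `d L ^ 2`, so this comparison
      -- gives the stated constant.
      have hsqrt : (5 / 2 : ℝ) ≤ √(2 * Real.pi) := by
        apply Real.le_sqrt_of_sq_le
        linarith [Real.pi_gt_d2]
      have e1 : 3 * (d : ℝ) ^ 2 / δ ^ 2 * σ ^ 2 + 3 * (d : ℝ) ^ 2 / δ ^ 2 * σ ^ 2 +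
          6 * (d : ℝ) ^ 2 / δ ^ 2 * (60 * (L * δ) ^ 2 / d) =
          6 * (d : ℝ) ^ 2 * σ ^ 2 / δ ^ 2 + 144 * (5 / 2) * d * (L : ℝ) ^ 2 := by
        field_simp
        ring
      rw [e1]
      gcongr

end IsOnePointSampling

end Estimator

/-! ### The main theorem. -/

theorem lemma3p2 {d : ℕ} (hd : 1 ≤ d)
    {S Ω : Type*} [MeasurableSpace S] [mΩ : MeasurableSpace Ω]
    (μ : Measure Ω) [IsProbabilityMeasure μ]
    (Ξ : Kernel (EuclideanSpace ℝ (Fin d)) S) [IsMarkovKernel Ξ]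
    (F : EuclideanSpace ℝ (Fin d) → S → ℝ) (hF : Measurable (Function.uncurry F))
    (f : EuclideanSpace ℝ (Fin d) → ℝ) (σ : ℝ) (hSZO : IsStochasticOracle Ξ F f σ)
    (L : ℝ≥0) (hL : LipschitzWith L f)
    (δ : ℝ) (hδ : 0 < δ)
    (𝒢 : Filtration ℕ mΩ) (y u : ℕ → Ω → EuclideanSpace ℝ (Fin d)) (ξ : ℕ → Ω → S)
    (hsamp : IsOnePointSampling μ Ξ δ 𝒢 y u ξ)
    (g : ℕ → Ω → EuclideanSpace ℝ (Fin d))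
    (hg : ∀ t, 1 ≤ t → ∀ ω, g t ω = onePointResidual F δ (y t ω) (u t ω) (ξ t ω)
      (y (t - 1) ω) (u (t - 1) ω) (ξ (t - 1) ω))
    (t : ℕ) (ht : 1 ≤ t) :
    Differentiable ℝ (smoothedSurrogate f δ) ∧
    (Integrable (fun ω => y t ω - y (t - 1) ω) μ → Integrable (g t) μ) ∧
    (Integrable (g t) μ →
      μ[g t | 𝒢 t] =ᵐ[μ] fun ω => gradient (smoothedSurrogate f δ) (y t ω)) ∧
    ∫⁻ ω, ‖g t ω‖ₑ ^ 2 ∂μ ≤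
      ENNReal.ofReal (6 * (d : ℝ) ^ 2 * σ ^ 2 / δ ^ 2
        + 144 * √(2 * Real.pi) * (d : ℝ) * (L : ℝ) ^ 2)
      + ENNReal.ofReal (6 * (d : ℝ) ^ 2 * (L : ℝ) ^ 2 / δ ^ 2)
        * ∫⁻ ω, ‖y t ω - y (t - 1) ω‖ₑ ^ 2 ∂μ := by
  obtain ⟨s, rfl⟩ : ∃ s, t = s + 1 := ⟨t - 1, by omega⟩
  rw [Nat.add_sub_cancel, funext (hg (s + 1) ht), Nat.add_sub_cancel]
  exact ⟨fun x => (hasGradientAt_smoothedSurrogate hd hL hδ x).differentiableAt,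
    hsamp.integrable_onePointResidual hSZO hF hL s,
    hsamp.condExp_onePointResidual hd hδ hSZO hF hL s,
    hsamp.lintegral_onePointResidual_sq_le hd hδ hSZO hF hL s⟩
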